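/- Let $F:\mathbb R^k\to\mathbb R^k$ be smooth with $F(0)=0$, and consider the difference equation $U(n+1)=F(U(n))$, $n\in\mathbb Z$. Assume: (i) a finite group $G$ acts on $\mathbb R^k$ by orthogonal maps $T(\theta)$, $\theta\in G$, with $F(T(\theta)U)=T(\theta)F(U)$ for all $\theta\in G$, $U\in\mathbb R^k$; (ii) $0$ is hyperbolic: there is $r>1$ such that every complex eigenvalue $\nu$ of $DF(0)$ satisfies $|\nu|\le 1/r$ or $|\nu|\ge r$, where eigenvalues with $|\nu|=1/r$ or $|\nu|=r$ (if any) are semisimple; and the stable and unstable eigenspaces $E^s,E^u$ of $DF(0)$ have dimension at least $1$; (iii) $Q:\mathbb Z\to\mathbb R^k$ is a homoclinic orbit: $Q(n+1)=F(Q(n))$ for all $n$, and $Q(n)\to0$ as $n\to\pm\infty$; (iv) the stable and unstable manifolds $W^s(0)$, $W^u(0)$ intersect transversely along $Q$: $T_{Q(n)}W^s(0)+T_{Q(n)}W^u(0)=\mathbb R^k$ for all $n\in\mathbb Z$. (Here the tangent spaces are those of the immersed manifolds: $T_{p}W^s(0)$ is spanned by the velocities at $p$ of curves $\gamma$ through $p$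 with $F^n(\gamma(t))\to0$ as $n\to\infty$ uniformly in $t$, and $T_{Q(n)}W^u(0)$ by the velocities at $Q(n)$ of curves $t\mapsto\Gamma_t(0)$, where $\Gamma_t(j)$, $j\ge0$, are backward orbits, $F(\Gamma_t(j+1))=\Gamma_t(j)$, differentiable in $t$ at $t=0$ for each $j$, with $\Gamma_0(j)=Q(n-j)$ and $\Gamma_t(j)\to0$ as $j\to\infty$ uniformly in $t$. No invertibility of $F$ is assumed.) Then there are an integer $N_0\ge1$ and constants $\delta,C>0$ with the following property. Let $m>1$, let $N_1,\dots,N_{m-1}\ge N_0$ be integers and let $\theta_1,\dots,\theta_m\in G$. Put $N_i^+=\lfloor N_i/2\rfloor$, $N_i^-=N_i-N_i^+$, $N_0^-=N_m^+=\infty$, $N=\frac12\min_i N_i$ and $c_i=N_1+\dots+N_{i-1}$ (so $c_1=0$). For $U:\mathbb Z\to\mathbb R^k$ define remainder terms $\tilde Q_i^\pm$, $1\le i\le m$, by $$U(c_i+n)=T(\theta_i)Q(n)+\tilde Q_i^-(n)\quad (n\in[-N_{i-1}^-,0]),\qquad U(c_i+n)=T(\theta_i)Q(n)+\tilde Q_i^+(n)\quad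 (n\in[0,N_i^+]).$$ Then there is exactly one solution $U$ of $U(n+1)=F(U(n))$, $n\in\mathbb Z$, all of whose remainder terms satisfy $\|\tilde Q_i^\pm\|_\infty\le\delta$. This solution (the $m$-pulse solution) satisfies $U(n)\to0$ as $n\to\pm\infty$, and $$\|\tilde Q_i^\pm\|_\infty\le C r^{-N}\qquad(1\le i\le m),$$ $$|\tilde Q_i^+(N_i^+)-T(\theta_{i+1})Q(-N_i^-)|\le C r^{-2N},\qquad |\tilde Q_{i+1}^-(-N_i^-)-T(\theta_i)Q(N_i^+)|\le C r^{-2N}\qquad(1\le i\le m-1).$$ -/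

import Mathlib

open Filter Topology

namespace MultiPulse

/-- The complexification, acting on `ℂ^k`, of a real linear map of `ℝ^k`. -/
noncomputable def complexification {k : ℕ}
    (A : EuclideanSpace ℝ (Fin k) →L[ℝ] EuclideanSpace ℝ (Fin k)) :
    Module.End ℂ (Fin k → ℂ) :=
  Matrix.toLin' (Matrix.of fun i j => ((A (EuclideanSpace.single j (1 : ℝ)) i : ℝ) : ℂ))

/-- The (complexified) stable eigenspace of `A`: the sum of the generalized eigenspaces of the
eigenvalues inside the unit circle. Its complex dimension is the real dimension of `E^s`. -/
noncomputable def stableEigenspace {k : ℕ}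
    (A : EuclideanSpace ℝ (Fin k) →L[ℝ] EuclideanSpace ℝ (Fin k)) :
    Submodule ℂ (Fin k → ℂ) :=
  ⨆ ν : {ν : ℂ // ‖ν‖ < 1}, (complexification A).maxGenEigenspace ν.1

/-- The (complexified) unstable eigenspace of `A`: the sum of the generalized eigenspaces of the
eigenvalues outside the unit circle. -/
noncomputable def unstableEigenspace {k : ℕ}
    (A : EuclideanSpace ℝ (Fin k) →L[ℝ] EuclideanSpace ℝ (Fin k)) :
    Submodule ℂ (Fin k → ℂ) :=
  ⨆ ν : {ν : ℂ // 1 < ‖ν‖}, (complexification A).maxGenEigenspace ν.1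

/-- `A` is hyperbolic with rate `r > 1`: every complex eigenvalue `ν` has `|ν| ≤ 1/r` or
`|ν| ≥ r`, the eigenvalues on the two extremal circles (if there are any) being semisimple, and
the stable and the unstable eigenspace are nontrivial. -/
structure IsHyperbolic {k : ℕ}
    (A : EuclideanSpace ℝ (Fin k) →L[ℝ] EuclideanSpace ℝ (Fin k)) (r : ℝ) : Prop where
  one_lt : 1 < r
  gap : ∀ ν : ℂ, (complexification A).HasEigenvalue ν → ‖ν‖ ≤ 1 / r ∨ r ≤ ‖ν‖
  semisimple : ∀ ν : ℂ, ‖ν‖ = 1 / r ∨ ‖ν‖ = r →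
    (complexification A).maxGenEigenspace ν = (complexification A).eigenspace ν
  one_le_dim_stable : 1 ≤ Module.finrank ℂ (stableEigenspace A)
  one_le_dim_unstable : 1 ≤ Module.finrank ℂ (unstableEigenspace A)

section Dynamics

variable {E : Type*} [NormedAddCommGroup E] [NormedSpace ℝ E]

/-- `U` is a solution, on all of `ℤ`, of the difference equation `U(n+1) = F(U(n))`. -/
def IsOrbit (F : E → E) (U : ℤ → E) : Prop :=
  ∀ n : ℤ, U (n + 1) = F (U n)

/-- `U` is an orbit which connects the equilibrium `0` to itself. -/
def IsHomoclinicOrbit (F : E → E) (U : ℤ → E) : Prop :=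
  IsOrbit F U ∧ Tendsto U atTop (𝓝 0) ∧ Tendsto U atBot (𝓝 0)

/-- The stable manifold `W^s(0)` of the fixed point `0`, as a set. -/
def stableManifold (F : E → E) : Set E :=
  {x | Tendsto (fun n : ℕ => F^[n] x) atTop (𝓝 0)}

/-- `y` is a backward orbit (`y j` is a `j`-th preimage of `y 0`) converging to `0`. -/
def IsBackwardOrbit (F : E → E) (y : ℕ → E) : Prop :=
  (∀ j : ℕ, F (y (j + 1)) = y j) ∧ Tendsto y atTop (𝓝 0)

/-- The unstable manifold `W^u(0)` of the fixed point `0`, as a set. -/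
def unstableManifold (F : E → E) : Set E :=
  {x | ∃ y : ℕ → E, y 0 = x ∧ IsBackwardOrbit F y}

/-- The tangent space of `W^s(0)` at `p`: the velocities at `p` of the curves in `W^s(0)` through
`p`. Since `W^s(0)` is in general only an immersed submanifold (it may accumulate on itself), the
curves have to be continuous for its intrinsic topology, that is, a common iterate of `F` takes the
curve, near `p`, into any given local stable manifold: the convergence `F^n (γ t) → 0` is
uniform in `t`. -/
def stableTangentSpace (F : E → E) (p : E) : Submodule ℝ E :=
  Submodule.span ℝ {v | ∃ (γ : ℝ → E) (τ : ℝ), 0 < τ ∧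
    γ 0 = p ∧ HasDerivAt γ v 0 ∧
    (∀ t ∈ Set.Ioo (-τ) τ, γ t ∈ stableManifold F) ∧
    TendstoUniformlyOn (fun (n : ℕ) (t : ℝ) => F^[n] (γ t)) (fun _ => 0) atTop (Set.Ioo (-τ) τ)}

/-- The tangent space of `W^u(0)` at the point `p = y 0` with backward orbit `y` (which is
determined by `p` if `F` is injective): the velocities at `p` of the curves in `W^u(0)` through
`p`. As for `W^s(0)`, the curves, here `t ↦ Γ t 0`, are those for the structure of immersed
submanifold of `W^u(0)`: they are carried along by differentiable curves `t ↦ Γ t j` of `j`-th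
preimages which converge to `0` uniformly in `t`. If `F` is a diffeomorphism, then
`Γ t j = F^{-j} (Γ t 0)`, and this is the tangent space of the stable manifold of `F^{-1}`. -/
def unstableTangentSpace (F : E → E) (y : ℕ → E) : Submodule ℝ E :=
  Submodule.span ℝ {v | ∃ (Γ : ℝ → ℕ → E) (τ : ℝ), 0 < τ ∧
    Γ 0 = y ∧ HasDerivAt (fun t => Γ t 0) v 0 ∧
    (∀ j : ℕ, DifferentiableAt ℝ (fun t => Γ t j) 0) ∧
    (∀ t ∈ Set.Ioo (-τ) τ, IsBackwardOrbit F (Γ t)) ∧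
    TendstoUniformlyOn (fun (j : ℕ) (t : ℝ) => Γ t j) (fun _ => 0) atTop (Set.Ioo (-τ) τ)}

/-- `W^s(0)` and `W^u(0)` intersect transversely along the homoclinic orbit `Q`: at every `Q(n)`
the two tangent spaces together span the whole space. -/
def IntersectTransverselyAlong (F : E → E) (Q : ℤ → E) : Prop :=
  ∀ n : ℤ, stableTangentSpace F (Q n) ⊔ unstableTangentSpace F (fun j : ℕ => Q (n - j)) = ⊤

end Dynamics

/-! In the following the pulses carry the indices `1, …, m`; `N i` is the distance between the
pulses `i` and `i + 1`, for `1 ≤ i ≤ m - 1`. Other values of `N` play no role. -/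

/-- `N_i^+ = ⌊N_i / 2⌋`. -/
def distPlus (N : ℕ → ℕ) (i : ℕ) : ℤ := ((N i / 2 : ℕ) : ℤ)

/-- `N_i^- = N_i - N_i^+`. -/
def distMinus (N : ℕ → ℕ) (i : ℕ) : ℤ := (N i : ℤ) - distPlus N i

/-- The number `½ min {N_1, …, N_{m-1}}`. -/
noncomputable def halfMinDist (m : ℕ) (N : ℕ → ℕ) : ℝ :=
  ((sInf (N '' Set.Icc 1 (m - 1)) : ℕ) : ℝ) / 2

/-- The position `N_1 + … + N_{i-1}` of the centre of the `i`-th pulse; the first one is at `0`. -/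
def center (N : ℕ → ℕ) (i : ℕ) : ℤ := ∑ j ∈ Finset.Ico 1 i, (N j : ℤ)

/-- The domain `[-N_{i-1}^-, 0]` of the left half of the `i`-th pulse, where `N_0^- = ∞`. -/
def leftDomain (N : ℕ → ℕ) (i : ℕ) : Set ℤ :=
  {n | n ≤ 0 ∧ (i ≠ 1 → -distMinus N (i - 1) ≤ n)}

/-- The domain `[0, N_i^+]` of the right half of the `i`-th pulse, where `N_m^+ = ∞`. -/
def rightDomain (m : ℕ) (N : ℕ → ℕ) (i : ℕ) : Set ℤ :=
  {n | 0 ≤ n ∧ (i ≠ m → n ≤ distPlus N i)}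

section Pulses

variable {k : ℕ} {G : Type*} [Group G]

/-- The remainder of a sequence `U` around its `i`-th pulse. The pieces `U_i^-` and `U_i^+` of `U`
are both given by `n ↦ U (center N i + n)`, on `leftDomain N i` and `rightDomain m N i`
respectively, and the remainder terms are defined by `U_i^± (n) = T(θ_i) Q(n) + remainder`. -/
noncomputable def remainder
    (T : G →* (EuclideanSpace ℝ (Fin k) ≃ₗᵢ[ℝ] EuclideanSpace ℝ (Fin k)))
    (Q : ℤ → EuclideanSpace ℝ (Fin k)) (N : ℕ → ℕ) (θ : ℕ → G)
    (U : ℤ → EuclideanSpace ℝ (Fin k)) (i : ℕ) (n : ℤ) : EuclideanSpace ℝ (Fin k) :=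
  U (center N i + n) - T (θ i) (Q n)

/-- All `2m` remainder terms of `U` have supremum norm at most `δ`. -/
def RemaindersLE
    (T : G →* (EuclideanSpace ℝ (Fin k) ≃ₗᵢ[ℝ] EuclideanSpace ℝ (Fin k)))
    (Q : ℤ → EuclideanSpace ℝ (Fin k)) (m : ℕ) (N : ℕ → ℕ) (θ : ℕ → G)
    (U : ℤ → EuclideanSpace ℝ (Fin k)) (δ : ℝ) : Prop :=
  ∀ i : ℕ, 1 ≤ i → i ≤ m → ∀ n ∈ leftDomain N i ∪ rightDomain m N i,
    ‖remainder T Q N θ U i n‖ ≤ δ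

end Pulses

end MultiPulse

/-! The sum `W` of the rotated and shifted copies of `Q` is almost an orbit: the copies are orbits,
and since their tails decay like `r ^ (-|n|)` (the Green function of `DF(0)` does) and interact only
quadratically, `W (n + 1) - F (W n)` is `O(r ^ (-2N))`.

Along `Q`, transversality says that bounded forward and bounded backward solutions of the
variational equation span the whole space, so `V ↦ (V (n + 1) - DF(Q n) (V n))` is surjective on
`ℓ^∞`. It is a compact perturbation of the invertible operator belonging to `DF(0)`, hence Fredholm
of index zero, hence bijective. On a long window `DF(W n)` is close to `DF` along a single copy of
`Q`, so multiplying by a slowly varying cutoff carries the a priori bound over to `W`, with a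
constant that depends neither on the number of pulses nor on their distances and rotations.

With this bound the equation for orbits near `W` is a contraction on a ball of uniform radius, and
its solution is `O(r ^ (-2N))` close to `W`. The remainder terms are then, up to that error, the
tails of the other copies: `O(r ^ (-N))` in general, and at a midpoint the one tail of the
neighbouring copy plus `O(r ^ (-2N))`. -/

namespace MultiPulse

open scoped ENNReal

/-- The Banach space `ℓ^∞(ℤ, E)` of bounded two-sided sequences in `E`. -/
abbrev BddSeq (E : Type*) [NormedAddCommGroup E] : AddSubgroup (PreLp fun _ : ℤ => E) :=
  lp (fun _ : ℤ => E) ∞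

theorem memℓp_infty_of_forall_norm_le {ι E : Type*} [NormedAddCommGroup E] {V : ι → E} {C : ℝ}
    (hV : ∀ n, ‖V n‖ ≤ C) : Memℓp V ∞ :=
  memℓp_infty ⟨C, Set.forall_mem_range.2 hV⟩

theorem exists_forall_norm_le_of_memℓp_infty {ι E : Type*} [NormedAddCommGroup E] {V : ι → E}
    (hV : Memℓp V ∞) : ∃ C, ∀ n, ‖V n‖ ≤ C :=
  (memℓp_infty_iff.1 hV).imp fun _ hC n => hC ⟨n, rfl⟩

section DifferenceOperator

variable {𝕜 E : Type*}

theorem injective_iff_surjective_of_sub_mem [DivisionRing 𝕜] [AddCommGroup E] [Module 𝕜 E]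
    {T : E →ₗ[𝕜] E} {F : Submodule 𝕜 E} [FiniteDimensional 𝕜 F] (hTF : ∀ x, T x - x ∈ F) :
    Function.Injective T ↔ Function.Surjective T := by
  have hF : ∀ x ∈ F, T x ∈ F := fun x hx => (F.sub_mem_iff_left hx).1 (hTF x)
  have mem_of_map_mem : ∀ x, T x ∈ F → x ∈ F := fun x hx => (F.sub_mem_iff_right hx).1 (hTF x)
  have restrict_iff := LinearMap.injective_iff_surjective (f := T.restrict hF)
  constructor
  · intro hinj y
    obtain ⟨f, hf⟩ := restrict_iff.1
      (fun a b hab => Subtype.ext (hinj (congrArg Subtype.val hab))) ⟨T y - y, hTF y⟩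
    have hf' : T f = T y - y := congrArg Subtype.val hf
    exact ⟨y - f, by rw [map_sub, hf', sub_sub_cancel]⟩
  · intro hsurj
    have hinj := restrict_iff.2 fun y => by
      obtain ⟨x, hx⟩ := hsurj y
      exact ⟨⟨x, mem_of_map_mem x (hx ▸ y.2)⟩, Subtype.ext hx⟩
    refine (injective_iff_map_eq_zero T).2 fun x hx => ?_
    have hxF : x ∈ F := mem_of_map_mem x (hx ▸ F.zero_mem)
    exact congrArg Subtype.val
      (hinj (Subtype.ext (by simp [hx])) : (⟨x, hxF⟩ : F) = 0)

variable [NontriviallyNormedField 𝕜] [NormedAddCommGroup E] [NormedSpace 𝕜 E]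

theorem norm_apply_apply_le (B : BddSeq (E →L[𝕜] E)) (V : BddSeq E) (n : ℤ) :
    ‖B n (V n)‖ ≤ ‖B‖ * ‖V‖ :=
  (B n).le_of_opNorm_le_of_le (lp.norm_apply_le_norm ENNReal.top_ne_zero B n)
    (lp.norm_apply_le_norm ENNReal.top_ne_zero V n)

theorem norm_succ_sub_apply_le (B : BddSeq (E →L[𝕜] E)) (V : BddSeq E) (n : ℤ) :
    ‖V (n + 1) - B n (V n)‖ ≤ (1 + ‖B‖) * ‖V‖ := by
  rw [add_mul, one_mul]
  exact norm_sub_le_of_le (lp.norm_apply_le_norm ENNReal.top_ne_zero V (n + 1))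
    (norm_apply_apply_le B V n)

/-- The linear difference operator `V ↦ (V (n + 1) - B n (V n))` on bounded sequences; its kernel
consists of the bounded solutions of `V (n + 1) = B n (V n)`. -/
noncomputable def differenceOp (B : BddSeq (E →L[𝕜] E)) : BddSeq E →L[𝕜] BddSeq E :=
  LinearMap.mkContinuous
    { toFun := fun V => ⟨fun n => V (n + 1) - B n (V n),
        memℓp_infty_of_forall_norm_le (norm_succ_sub_apply_le B V)⟩
      map_add' := fun V W => lp.ext <| funext fun n => by
        simp only [lp.coeFn_add, Pi.add_apply, map_add, add_sub_add_comm]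
      map_smul' := fun c V => lp.ext <| funext fun n => by
        simp only [lp.coeFn_smul, Pi.smul_apply, map_smul, smul_sub, RingHom.id_apply] }
    (1 + ‖B‖) fun V => lp.norm_le_of_forall_le (by positivity) (norm_succ_sub_apply_le B V)

theorem differenceOp_apply (B : BddSeq (E →L[𝕜] E)) (V : BddSeq E) (n : ℤ) :
    differenceOp B V n = V (n + 1) - B n (V n) :=
  rfl

theorem norm_differenceOp_sub_le (B B' : BddSeq (E →L[𝕜] E)) :
    ‖differenceOp B' - differenceOp B‖ ≤ ‖B' - B‖ := by
  refine ContinuousLinearMap.opNorm_le_bound _ (norm_nonneg _) fun V =>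
    lp.norm_le_of_forall_le (by positivity) fun n => ?_
  have hdiff : (differenceOp B' - differenceOp B) V n = -((B' - B) n (V n)) := by
    simp only [sub_apply, lp.coeFn_sub, Pi.sub_apply, differenceOp_apply,
      sub_sub_sub_cancel_left, neg_sub]
  rw [hdiff, norm_neg]
  exact norm_apply_apply_le _ _ _

theorem continuous_differenceOp : Continuous (differenceOp (𝕜 := 𝕜) (E := E)) :=
  LipschitzWith.continuous (K := 1) <| LipschitzWith.of_dist_le_mul fun B B' => by
    simpa only [dist_eq_norm, NNReal.coe_one, one_mul] using norm_differenceOp_sub_le B' B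

theorem eventually_bijective_differenceOp [CompleteSpace E] {B : BddSeq (E →L[𝕜] E)}
    (hB : Function.Bijective (differenceOp B)) :
    ∀ᶠ B' in 𝓝 B, Function.Bijective (differenceOp B') := by
  have hnhds := (ContinuousLinearEquiv.ofBijective (differenceOp B)
    (LinearMap.ker_eq_bot.2 hB.1) (LinearMap.range_eq_top.2 hB.2)).nhds
  rw [ContinuousLinearEquiv.coe_ofBijective] at hnhds
  filter_upwards [continuous_differenceOp.continuousAt.preimage_mem_nhds hnhds] with B' hB'
  obtain ⟨e, he⟩ := hB'
  exact he ▸ e.bijective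

theorem exists_norm_le_mul_norm_differenceOp [CompleteSpace E] {B : BddSeq (E →L[𝕜] E)}
    (hB : Function.Bijective (differenceOp B)) :
    ∃ K > 0, ∀ V, ‖V‖ ≤ K * ‖differenceOp B V‖ := by
  obtain ⟨K, hK, hle⟩ := (ContinuousLinearEquiv.ofBijective (differenceOp B)
    (LinearMap.ker_eq_bot.2 hB.1) (LinearMap.range_eq_top.2 hB.2)).symm.toContinuousLinearMap.bound
  refine ⟨K, hK, fun V => ?_⟩
  have hV := hle (differenceOp B V)
  exact (congrArg norm (ContinuousLinearEquiv.ofBijective_symm_apply_apply _ _ _ V)).symm.trans_le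
    hV

theorem eq_sum_single {V : BddSeq E} {s : Finset ℤ} (hV : ∀ n ∉ s, V n = 0) :
    V = ∑ j ∈ s, lp.single ∞ j (V j) := by
  refine lp.ext <| funext fun n => ?_
  simp only [lp.coeFn_sum, Finset.sum_apply, lp.single_apply]
  by_cases hn : n ∈ s
  · rw [Finset.sum_eq_single_of_mem n hn fun j _ hj => Pi.single_eq_of_ne hj.symm _,
      Pi.single_eq_same]
  · rw [hV n hn, Finset.sum_eq_zero fun j hj =>
      Pi.single_eq_of_ne (ne_of_mem_of_not_mem hj hn).symm _]

theorem injective_iff_surjective_differenceOp_of_eq_off_finset [FiniteDimensional 𝕜 E]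
    {B B' : BddSeq (E →L[𝕜] E)} (hB : Function.Bijective (differenceOp B)) (s : Finset ℤ)
    (hs : ∀ n ∉ s, B' n = B n) :
    Function.Injective (differenceOp B') ↔ Function.Surjective (differenceOp B') := by
  let e := LinearEquiv.ofBijective (differenceOp B : BddSeq E →ₗ[𝕜] BddSeq E) hB
  let supported : Submodule 𝕜 (BddSeq E) :=
    ⨆ j : s, LinearMap.range (lp.lsingle (𝕜 := 𝕜) (E := fun _ : ℤ => E) ∞ (j : ℤ))
  let T : BddSeq E →ₗ[𝕜] BddSeq E := e.symm.toLinearMap ∘ₗ (differenceOp B').toLinearMap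
  have hT : ∀ V, T V - V ∈ supported.map e.symm.toLinearMap := fun V => by
    refine ⟨differenceOp B' V - differenceOp B V, ?_, ?_⟩
    · rw [eq_sum_single (V := differenceOp B' V - differenceOp B V) (s := s) fun n hn => by
        simp only [lp.coeFn_sub, Pi.sub_apply, differenceOp_apply, hs n hn, sub_self]]
      exact Submodule.sum_mem _ fun j hj => Submodule.mem_iSup_of_mem (⟨j, hj⟩ : s) ⟨_, rfl⟩
    · exact (map_sub e.symm _ _).trans (congrArg (T V - ·) (e.symm_apply_apply V))
  rw [← e.symm.injective.of_comp_iff (differenceOp B'),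
    ← Function.Surjective.of_comp_iff' e.symm.bijective (differenceOp B')]
  exact injective_iff_surjective_of_sub_mem hT

theorem exists_bijective_differenceOp_eq_off_finset [CompleteSpace E]
    {A B : BddSeq (E →L[𝕜] E)} (hA : Function.Bijective (differenceOp A))
    (hBA : Tendsto (fun n => B n - A n) cofinite (𝓝 0)) :
    ∃ (B' : BddSeq (E →L[𝕜] E)) (s : Finset ℤ),
      Function.Bijective (differenceOp B') ∧ ∀ n ∉ s, B n = B' n := by
  obtain ⟨ε, hε, hball⟩ := Metric.eventually_nhds_iff_ball.1 (eventually_bijective_differenceOp hA)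
  have hfin : {n | ¬ ‖B n - A n‖ < ε / 2}.Finite := by
    simpa only [Metric.mem_ball, dist_zero_right] using
      eventually_cofinite.1 (hBA.eventually (Metric.ball_mem_nhds 0 (half_pos hε)))
  let modification : BddSeq (E →L[𝕜] E) := ∑ j ∈ hfin.toFinset, lp.single ∞ j (B j - A j)
  have hmod : ∀ n, modification n = if n ∈ hfin.toFinset then B n - A n else 0 := fun n => by
    simp only [modification, lp.coeFn_sum, Finset.sum_apply, lp.single_apply, Pi.single_apply,
      Finset.sum_ite_eq]
  have hclose : ‖B - modification - A‖ ≤ ε / 2 :=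
    lp.norm_le_of_forall_le (half_pos hε).le fun n => by
      simp only [lp.coeFn_sub, Pi.sub_apply, hmod]
      split_ifs with hn
      · simpa using (half_pos hε).le
      · simpa using (not_not.1 fun h => hn (hfin.mem_toFinset.2 h)).le
  refine ⟨B - modification, hfin.toFinset, hball _ (by rw [mem_ball_iff_norm]; linarith),
    fun n hn => ?_⟩
  simp only [lp.coeFn_sub, Pi.sub_apply, hmod, if_neg hn, sub_zero]

theorem injective_iff_surjective_differenceOp_of_tendsto [CompleteSpace E] [FiniteDimensional 𝕜 E]
    {A B : BddSeq (E →L[𝕜] E)} (hA : Function.Bijective (differenceOp A))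
    (hBA : Tendsto (fun n => B n - A n) cofinite (𝓝 0)) :
    Function.Injective (differenceOp B) ↔ Function.Surjective (differenceOp B) := by
  obtain ⟨_, s, hB', hs⟩ := exists_bijective_differenceOp_eq_off_finset hA hBA
  exact injective_iff_surjective_differenceOp_of_eq_off_finset hB' s hs

end DifferenceOperator

section GreenSubmodule

theorem exists_le_mul_pow_of_succ_le {a : ℕ → ℝ} {ρ q C : ℝ} (hρ : 0 ≤ ρ) (hρq : ρ < q)
    (ha : ∀ n, a (n + 1) ≤ ρ * a n + C * q ^ n) : ∃ D, ∀ n, a n ≤ D * q ^ n := by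
  have hq : 0 < q := hρ.trans_lt hρq
  let D := max (a 0) (C / (q - ρ))
  have hD : C ≤ D * (q - ρ) := (div_le_iff₀ (sub_pos.2 hρq)).1 (le_max_right _ _)
  refine ⟨D, fun n => ?_⟩
  induction n with
  | zero => exact (le_max_left _ _).trans_eq (by rw [pow_zero, mul_one])
  | succ n ih =>
    calc a (n + 1) ≤ ρ * (D * q ^ n) + D * (q - ρ) * q ^ n := (ha n).trans (by gcongr)
      _ = D * q ^ (n + 1) := by ring

theorem zpow_neg_abs_natCast (r : ℝ) (n : ℕ) : r ^ (-|(n : ℤ)|) = r⁻¹ ^ n := by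
  rw [Nat.abs_cast, zpow_neg, zpow_natCast, inv_pow]

section NormedField

variable {𝕜 X : Type*} [NormedField 𝕜] [NormedAddCommGroup X] [NormedSpace 𝕜 X]
  {M : Module.End 𝕜 X} {ν : 𝕜} {x : X} {q r : ℝ}

theorem exists_norm_pow_apply_le (hν : ‖ν‖ < q) (k : ℕ)
    (hx : ((M - ν • (1 : Module.End 𝕜 X)) ^ k) x = 0) :
    ∃ C, ∀ n : ℕ, ‖(M ^ n) x‖ ≤ C * q ^ n := by
  induction k generalizing x with
  | zero => exact ⟨0, fun n => by simp [show x = 0 by simpa using hx]⟩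
  | succ k ih =>
    rw [pow_succ, Module.End.mul_apply] at hx
    obtain ⟨C, hC⟩ := ih hx
    refine exists_le_mul_pow_of_succ_le (norm_nonneg ν) hν (C := C) fun n => ?_
    have hsplit : (M ^ (n + 1)) x
        = ν • (M ^ n) x + (M ^ n) ((M - ν • (1 : Module.End 𝕜 X)) x) := by
      rw [pow_succ, Module.End.mul_apply, ← map_smul, ← map_add]
      simp
    rw [hsplit]
    exact norm_add_le_of_le (norm_smul_le _ _) (hC n)

theorem exists_backward_orbit (hν₀ : ν ≠ 0) (hν : ‖ν‖⁻¹ < q) (k : ℕ)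
    (hx : ((M - ν • (1 : Module.End 𝕜 X)) ^ k) x = 0) :
    ∃ (y : ℕ → X) (C : ℝ), y 0 = x ∧ (∀ j, M (y (j + 1)) = y j) ∧ ∀ j, ‖y j‖ ≤ C * q ^ j := by
  induction k generalizing x with
  | zero => exact ⟨fun _ => 0, 0, by simp [show x = 0 by simpa using hx]⟩
  | succ k ih =>
    rw [pow_succ, Module.End.mul_apply] at hx
    obtain ⟨y, C, hy₀, hy, hC⟩ := ih hx
    let z : ℕ → X := fun j => Nat.rec x (fun j w => ν⁻¹ • (w - y (j + 1))) j
    have hz : ∀ j, z (j + 1) = ν⁻¹ • (z j - y (j + 1)) := fun j => rfl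
    have hMz : ∀ j, M (z j) = ν • z j + y j := by
      intro j
      induction j with
      | zero => simp [hy₀, z]
      | succ j ih =>
        rw [hz, map_smul, map_sub, ih, hy, add_sub_cancel_right, inv_smul_smul₀ hν₀,
          smul_inv_smul₀ hν₀, sub_add_cancel]
    obtain ⟨D, hD⟩ := exists_le_mul_pow_of_succ_le (a := fun j => ‖z j‖) (C := ‖ν‖⁻¹ * (C * q))
      (inv_nonneg.2 (norm_nonneg ν)) hν fun j => by
        rw [hz, norm_smul, norm_inv]
        calc ‖ν‖⁻¹ * ‖z j - y (j + 1)‖ ≤ ‖ν‖⁻¹ * (‖z j‖ + C * q ^ (j + 1)) := by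
              gcongr
              exact norm_sub_le_of_le le_rfl (hC _)
          _ = ‖ν‖⁻¹ * ‖z j‖ + ‖ν‖⁻¹ * (C * q) * q ^ j := by ring
    refine ⟨z, D, rfl, fun j => ?_, hD⟩
    rw [hMz (j + 1), hz, smul_inv_smul₀ hν₀, sub_add_cancel]

/-- The vectors `x` for which the inhomogeneous equation `g (n + 1) = M (g n) + δ x`, where `δ x`
is the sequence with value `x` at `-1` and `0` elsewhere, has a solution `g` which decays with rate
`r` at both ends. -/
def greenSubmodule (M : Module.End 𝕜 X) (r : ℝ) : Submodule 𝕜 X where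
  carrier := {x | ∃ g : ℤ → X, (∃ C, ∀ n, ‖g n‖ ≤ C * r ^ (-|n|)) ∧
    ∀ n, g (n + 1) - M (g n) = if n = -1 then x else 0}
  zero_mem' := ⟨fun _ => 0, ⟨0, by simp⟩, by simp⟩
  add_mem' := by
    rintro x y ⟨g, ⟨C, hC⟩, hg⟩ ⟨h, ⟨D, hD⟩, hh⟩
    refine ⟨g + h, ⟨C + D, fun n => ?_⟩, fun n => ?_⟩
    · rw [add_mul]
      exact norm_add_le_of_le (hC n) (hD n)
    · rw [Pi.add_apply, Pi.add_apply, map_add, add_sub_add_comm, hg, hh, ite_add_ite, add_zero]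
  smul_mem' := by
    rintro c x ⟨g, ⟨C, hC⟩, hg⟩
    refine ⟨c • g, ⟨‖c‖ * C, fun n => ?_⟩, fun n => ?_⟩
    · rw [mul_assoc]
      exact (norm_smul_le _ _).trans (mul_le_mul_of_nonneg_left (hC n) (norm_nonneg c))
    · rw [Pi.smul_apply, Pi.smul_apply, map_smul, ← smul_sub, hg, smul_ite, smul_zero]

theorem mem_greenSubmodule_of_forward_orbit (hr : 0 < r) {y : ℕ → X} {C : ℝ} (hy₀ : y 0 = x)
    (hy : ∀ j, M (y j) = y (j + 1)) (hC : ∀ j, ‖y j‖ ≤ C * r⁻¹ ^ j) : x ∈ greenSubmodule M r := by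
  have hC₀ : 0 ≤ C := by simpa using (norm_nonneg _).trans (hC 0)
  refine ⟨fun n => if 0 ≤ n then y n.toNat else 0, ⟨C, fun n => ?_⟩, fun n => ?_⟩
  · rcases le_or_gt 0 n with hn | hn
    · lift n to ℕ using hn
      rw [zpow_neg_abs_natCast]
      simpa using hC n
    · simp only [not_le.2 hn, if_false, norm_zero]
      positivity
  · rcases lt_trichotomy n (-1) with hn | rfl | hn
    · simp [show ¬ (0 ≤ n + 1) by omega, show ¬ (0 ≤ n) by omega, hn.ne]
    · simpa using hy₀
    · lift n to ℕ using by omega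
      simp [show ((n : ℤ) + 1).toNat = n + 1 by omega, show (n : ℤ) ≠ -1 by omega,
        show (0 : ℤ) ≤ n + 1 by omega, hy]

theorem mem_greenSubmodule_of_backward_orbit (hr : 0 < r) {y : ℕ → X} {C : ℝ} (hy₀ : y 0 = x)
    (hy : ∀ j, M (y (j + 1)) = y j) (hC : ∀ j, ‖y j‖ ≤ C * r⁻¹ ^ j) : x ∈ greenSubmodule M r := by
  have hC₀ : 0 ≤ C := by simpa using (norm_nonneg _).trans (hC 0)
  refine ⟨fun n => if 0 ≤ n then 0 else -y (-n).toNat, ⟨C, fun n => ?_⟩, fun n => ?_⟩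
  · rcases le_or_gt 0 n with hn | hn
    · simp only [hn, if_true, norm_zero]
      positivity
    · obtain ⟨j, rfl⟩ : ∃ j : ℕ, n = -j := ⟨n.natAbs, by omega⟩
      rw [abs_neg, zpow_neg_abs_natCast]
      simpa [show j ≠ 0 by omega] using hC j
  · rcases lt_trichotomy n (-1) with hn | rfl | hn
    · obtain ⟨j, rfl⟩ : ∃ j : ℕ, n = -(j + 1 : ℕ) := ⟨(n + 1).natAbs, by omega⟩
      have hj : (-(-((j + 1 : ℕ) : ℤ) + 1)).toNat = j := by omega
      have hj' : (-(-((j + 1 : ℕ) : ℤ))).toNat = j + 1 := by omega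
      simp only [show ¬ (0 ≤ -((j + 1 : ℕ) : ℤ) + 1) by omega,
        show ¬ (0 ≤ -((j + 1 : ℕ) : ℤ)) by omega, hj, hj', hn.ne, if_false, map_neg, hy,
        sub_self]
    · simpa [hy₀] using hy 0
    · simp [show 0 ≤ n by omega, show 0 ≤ n + 1 by omega, show n ≠ -1 by omega]

theorem eigenspace_le_greenSubmodule (hr : 0 < r) (hν : ‖ν‖ = 1 / r ∨ ‖ν‖ = r) :
    M.eigenspace ν ≤ greenSubmodule M r := by
  intro x hx
  have hMx : M x = ν • x := Module.End.mem_eigenspace_iff.1 hx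
  rw [one_div] at hν
  rcases hν with hν | hν
  · refine mem_greenSubmodule_of_forward_orbit hr (y := fun j => ν ^ j • x) (C := ‖x‖)
      (by simp) (fun j => ?_) fun j => ?_
    · rw [map_smul, hMx, smul_smul, pow_succ]
    · rw [norm_smul, norm_pow, hν, mul_comm]
  · have hν₀ : ν ≠ 0 := norm_pos_iff.1 (hν ▸ hr)
    refine mem_greenSubmodule_of_backward_orbit hr (y := fun j => ν⁻¹ ^ j • x) (C := ‖x‖)
      (by simp) (fun j => ?_) fun j => ?_
    · rw [map_smul, hMx, smul_smul, pow_succ, inv_mul_cancel_right₀ hν₀]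
    · rw [norm_smul, norm_pow, norm_inv, hν, mul_comm]

theorem maxGenEigenspace_le_greenSubmodule (hr : 0 < r) (hν : ‖ν‖ < 1 / r ∨ r < ‖ν‖) :
    M.maxGenEigenspace ν ≤ greenSubmodule M r := by
  intro x hx
  obtain ⟨k, hk⟩ := (Module.End.mem_maxGenEigenspace M ν x).1 hx
  rcases hν with hν | hν
  · obtain ⟨C, hC⟩ := exists_norm_pow_apply_le (one_div r ▸ hν) k hk
    exact mem_greenSubmodule_of_forward_orbit hr (y := fun j => (M ^ j) x) rfl
      (fun j => by rw [pow_succ', Module.End.mul_apply]) hC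
  · obtain ⟨y, C, hy₀, hy, hC⟩ := exists_backward_orbit (norm_pos_iff.1 (hr.trans hν))
      (inv_strictAnti₀ hr hν) k hk
    exact mem_greenSubmodule_of_backward_orbit hr hy₀ hy hC

theorem greenSubmodule_eq_top [IsAlgClosed 𝕜] [FiniteDimensional 𝕜 X] (hr : 0 < r)
    (gap : ∀ ν : 𝕜, M.HasEigenvalue ν → ‖ν‖ ≤ 1 / r ∨ r ≤ ‖ν‖)
    (semisimple : ∀ ν : 𝕜, ‖ν‖ = 1 / r ∨ ‖ν‖ = r → M.maxGenEigenspace ν = M.eigenspace ν) :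
    greenSubmodule M r = ⊤ := by
  rw [eq_top_iff, ← Module.End.iSup_maxGenEigenspace_eq_top M]
  refine iSup_le fun ν => ?_
  by_cases hν : M.HasEigenvalue ν
  · by_cases hs : ‖ν‖ = 1 / r ∨ ‖ν‖ = r
    · exact semisimple ν hs ▸ eigenspace_le_greenSubmodule hr hs
    · rw [not_or] at hs
      exact maxGenEigenspace_le_greenSubmodule hr
        ((gap ν hν).imp (lt_of_le_of_ne · hs.1) (lt_of_le_of_ne' · hs.2))
  · have hbot : M.maxGenEigenspace ν = ⊥ := by
      by_contra hne
      have hunif : M.HasUnifEigenvalue ν ⊤ := hne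
      exact hν (hunif.lt zero_lt_one)
    exact hbot ▸ bot_le

end NormedField

section BoundedOrbit

variable {𝕜 X : Type*} [NormedAddCommGroup X]

theorem eq_zero_of_forall_norm_le_pow_mul {x : X} {q C : ℝ} (hq₀ : 0 ≤ q) (hq : q < 1)
    (hx : ∀ j : ℕ, ‖x‖ ≤ q ^ j * C) : x = 0 := by
  have hlim := (tendsto_pow_atTop_nhds_zero_of_lt_one hq₀ hq).mul_const C
  rw [zero_mul] at hlim
  exact norm_le_zero_iff.1 (ge_of_tendsto' hlim hx)

theorem eq_zero_of_succ_eq_smul [NormedField 𝕜] [NormedSpace 𝕜 X] {ν : 𝕜} (hν : ‖ν‖ ≠ 1)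
    {V : ℤ → X} (hV : Memℓp V ∞) (hs : ∀ n, V (n + 1) = ν • V n) (n : ℤ) : V n = 0 := by
  obtain ⟨C, hC⟩ := exists_forall_norm_le_of_memℓp_infty hV
  have hpow : ∀ (j : ℕ) (n : ℤ), V (n + j) = ν ^ j • V n := fun j n => by
    induction j with
    | zero => simp
    | succ j ih => rw [Nat.cast_succ, ← add_assoc, hs, ih, smul_smul, pow_succ']
  rcases lt_or_gt_of_ne hν with hlt | hgt
  · refine eq_zero_of_forall_norm_le_pow_mul (C := C) (norm_nonneg ν) hlt fun j => ?_
    have hj := hpow j (n - j)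
    rw [sub_add_cancel] at hj
    rw [hj, norm_smul, norm_pow]
    gcongr
    exact hC _
  · refine eq_zero_of_forall_norm_le_pow_mul (C := C) (inv_nonneg.2 (norm_nonneg ν))
      (inv_lt_one_of_one_lt₀ hgt) fun j => ?_
    rw [inv_pow, ← div_eq_inv_mul, le_div_iff₀ (by positivity), mul_comm, ← norm_pow, ← norm_smul,
      ← hpow]
    exact hC _

variable [NontriviallyNormedField 𝕜] [CompleteSpace 𝕜] [NormedSpace 𝕜 X] [FiniteDimensional 𝕜 X]
  {M : Module.End 𝕜 X}

theorem memℓp_infty_map (M : Module.End 𝕜 X) {V : ℤ → X} (hV : Memℓp V ∞) :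
    Memℓp (fun n => M (V n)) ∞ := by
  obtain ⟨C, hC⟩ := exists_forall_norm_le_of_memℓp_infty hV
  exact memℓp_infty_of_forall_norm_le fun n =>
    (LinearMap.toContinuousLinearMap M).le_opNorm_of_le (hC n)

theorem eq_zero_of_aeval_prod_eq_zero (s : Multiset 𝕜) (hs : ∀ ν ∈ s, ‖ν‖ ≠ 1) {V : ℤ → X}
    (hV : Memℓp V ∞) (hM : ∀ n, V (n + 1) = M (V n))
    (hp : ∀ n, Polynomial.aeval M (s.map fun ν => Polynomial.X - Polynomial.C ν).prod (V n) = 0)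
    (n : ℤ) : V n = 0 := by
  induction s using Multiset.induction generalizing V n with
  | empty => simpa using hp n
  | cons ν s ih =>
    refine eq_zero_of_succ_eq_smul (hs ν (Multiset.mem_cons_self _ _)) hV (fun n => ?_) n
    have hsub := ih (fun μ hμ => hs μ (Multiset.mem_cons_of_mem hμ))
      (V := fun n => M (V n) - ν • V n) ((memℓp_infty_map M hV).sub (hV.const_smul ν))
      (fun n => by simp only [hM, map_sub, map_smul]) (fun n => by
        have hn := hp n
        rw [Multiset.map_cons, Multiset.prod_cons, mul_comm, map_mul, Module.End.mul_apply] at hn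
        simpa using hn) n
    rw [hM]
    exact sub_eq_zero.1 hsub

theorem eq_zero_of_bounded_orbit [IsAlgClosed 𝕜] (hM : ∀ ν : 𝕜, M.HasEigenvalue ν → ‖ν‖ ≠ 1)
    {V : ℤ → X} (hb : Memℓp V ∞) (hV : ∀ n, V (n + 1) = M (V n)) (n : ℤ) : V n = 0 := by
  have hroots := (IsAlgClosed.splits M.charpoly).eq_prod_roots
  rw [(LinearMap.charpoly_monic M).leadingCoeff, Polynomial.C_1, one_mul] at hroots
  refine eq_zero_of_aeval_prod_eq_zero M.charpoly.roots (fun ν hν => hM ν ?_) hb hV (fun n => ?_) n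
  · exact (Module.End.hasEigenvalue_iff_isRoot_charpoly M ν).2 (Polynomial.isRoot_of_mem_roots hν)
  · rw [← hroots, LinearMap.aeval_self_charpoly, LinearMap.zero_apply]

end BoundedOrbit

end GreenSubmodule

/-- `g` is a Green function on `ℤ` of the linear map `A`, decaying with rate `r > 1` at both ends,
and `A` has no nonzero bounded orbit. So `V (n + 1) = A (V n) + f n` has exactly one bounded
solution for bounded `f`, the convolution of `f` with `g`. -/
structure IsGreenFunction {𝕜 E : Type*} [NontriviallyNormedField 𝕜] [NormedAddCommGroup E]
    [NormedSpace 𝕜 E]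
    (A : E →L[𝕜] E) (r K : ℝ) (g : ℤ → E →L[𝕜] E) : Prop where
  one_lt : 1 < r
  pos : 0 < K
  norm_le : ∀ n, ‖g n‖ ≤ K * r ^ (-|n|)
  step : ∀ n e, g (n + 1) e - A (g n e) = if n = -1 then e else 0
  eq_zero : ∀ V : ℤ → E, Memℓp V ∞ → (∀ n, V (n + 1) = A (V n)) → ∀ n, V n = 0

section GreenFunction

variable {𝕜 E : Type*} [NontriviallyNormedField 𝕜] [NormedAddCommGroup E] [NormedSpace 𝕜 E]

theorem exists_norm_le_of_greenSubmodule_eq_top [CompleteSpace 𝕜] [FiniteDimensional 𝕜 E]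
    {A : E →L[𝕜] E} {r : ℝ} (hr : 0 ≤ r) (hA : greenSubmodule (A : Module.End 𝕜 E) r = ⊤) :
    ∃ K > 0, ∃ g : ℤ → E →L[𝕜] E, (∀ n, ‖g n‖ ≤ K * r ^ (-|n|)) ∧
      ∀ n e, g (n + 1) e - A (g n e) = if n = -1 then e else 0 := by
  let b := Module.finBasis 𝕜 E
  have hb : ∀ j, b j ∈ greenSubmodule (A : Module.End 𝕜 E) r := fun j => hA ▸ Submodule.mem_top
  choose h hdecay hstep using hb
  choose C hC using hdecay
  let coord : ∀ _, E →L[𝕜] 𝕜 := fun j => LinearMap.toContinuousLinearMap (b.coord j)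
  refine ⟨1 + ∑ j, ‖coord j‖ * |C j|, by positivity,
    fun n => ∑ j, (coord j).smulRight (h j n), fun n => ?_, fun n e => ?_⟩
  · rw [add_mul, Finset.sum_mul]
    refine (norm_sum_le _ _).trans (le_add_of_nonneg_of_le (by positivity)
      (Finset.sum_le_sum fun j _ => ?_))
    rw [ContinuousLinearMap.norm_smulRight_apply, mul_assoc]
    gcongr
    exact (hC j n).trans (mul_le_mul_of_nonneg_right (le_abs_self _) (by positivity))
  · have hstep' : ∀ j, h j (n + 1) - A (h j n) = if n = -1 then b j else 0 := (hstep · n)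
    simp only [sum_apply, ContinuousLinearMap.smulRight_apply, map_sum,
      map_smul, ← Finset.sum_sub_distrib, ← smul_sub, hstep']
    split_ifs
    · exact b.sum_repr e
    · simp only [smul_zero, Finset.sum_const_zero]

end GreenFunction

section Complexification

variable {k : ℕ}

/-- The real part of a vector of `ℂ^k`. -/
noncomputable def rePart : (Fin k → ℂ) →L[ℝ] EuclideanSpace ℝ (Fin k) :=
  (EuclideanSpace.equiv (Fin k) ℝ).symm.toContinuousLinearMap ∘L
    ContinuousLinearMap.pi fun i => Complex.reCLM ∘L ContinuousLinearMap.proj i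

theorem rePart_apply (z : Fin k → ℂ) (i : Fin k) : rePart z i = (z i).re :=
  rfl

theorem apply_eq_sum (A : EuclideanSpace ℝ (Fin k) →L[ℝ] EuclideanSpace ℝ (Fin k))
    (x : EuclideanSpace ℝ (Fin k)) (i : Fin k) :
    A x i = ∑ j, A (EuclideanSpace.single j (1 : ℝ)) i * x j := by
  conv_lhs => rw [← (EuclideanSpace.basisFun (Fin k) ℝ).sum_repr x, map_sum]
  simp [mul_comm]

theorem rePart_complexification (A : EuclideanSpace ℝ (Fin k) →L[ℝ] EuclideanSpace ℝ (Fin k))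
    (z : Fin k → ℂ) : rePart (complexification A z) = A (rePart z) := by
  ext i
  rw [apply_eq_sum]
  simp [complexification, Matrix.toLin'_apply, Matrix.mulVec, dotProduct, rePart_apply]

theorem complexification_ofReal (A : EuclideanSpace ℝ (Fin k) →L[ℝ] EuclideanSpace ℝ (Fin k))
    (x : EuclideanSpace ℝ (Fin k)) :
    complexification A (fun i => (x i : ℂ)) = fun i => ((A x i : ℝ) : ℂ) := by
  ext i
  rw [apply_eq_sum]
  simp [complexification, Matrix.toLin'_apply, Matrix.mulVec, dotProduct]

theorem rePart_mem_greenSubmodule {A : EuclideanSpace ℝ (Fin k) →L[ℝ] EuclideanSpace ℝ (Fin k)}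
    {r : ℝ} {z : Fin k → ℂ} (hz : z ∈ greenSubmodule (complexification A) r) :
    rePart z ∈ greenSubmodule (A : Module.End ℝ (EuclideanSpace ℝ (Fin k))) r := by
  obtain ⟨g, ⟨C, hC⟩, hg⟩ := hz
  refine ⟨fun n => rePart (g n), ⟨‖rePart (k := k)‖ * C, fun n => ?_⟩, fun n => ?_⟩
  · rw [mul_assoc]
    exact rePart.le_opNorm_of_le (hC n)
  · rw [ContinuousLinearMap.coe_coe, ← rePart_complexification, ← map_sub, hg, apply_ite rePart,
      map_zero]

theorem IsHyperbolic.greenSubmodule_eq_top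
    {A : EuclideanSpace ℝ (Fin k) →L[ℝ] EuclideanSpace ℝ (Fin k)} {r : ℝ}
    (hA : IsHyperbolic A r) :
    greenSubmodule (A : Module.End ℝ (EuclideanSpace ℝ (Fin k))) r = ⊤ := by
  have hr : 0 < r := one_pos.trans hA.one_lt
  refine eq_top_iff.2 fun x _ => ?_
  have hx : rePart (fun i => (x i : ℂ)) = x := by
    ext i
    rw [rePart_apply, Complex.ofReal_re]
  rw [← hx]
  refine rePart_mem_greenSubmodule ?_
  rw [MultiPulse.greenSubmodule_eq_top hr hA.gap hA.semisimple]
  exact Submodule.mem_top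

theorem IsHyperbolic.eq_zero_of_bounded_orbit
    {A : EuclideanSpace ℝ (Fin k) →L[ℝ] EuclideanSpace ℝ (Fin k)} {r : ℝ}
    (hA : IsHyperbolic A r) {V : ℤ → EuclideanSpace ℝ (Fin k)} (hb : Memℓp V ∞)
    (hV : ∀ n, V (n + 1) = A (V n)) (n : ℤ) : V n = 0 := by
  obtain ⟨D, hD⟩ := exists_forall_norm_le_of_memℓp_infty hb
  have hgap : ∀ ν : ℂ, (complexification A).HasEigenvalue ν → ‖ν‖ ≠ 1 := fun ν hν hν₁ => by
    have hr := hA.one_lt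
    rcases hA.gap ν hν with hle | hge
    · rw [hν₁, le_div_iff₀ (one_pos.trans hr)] at hle
      linarith
    · linarith
  have hzero := MultiPulse.eq_zero_of_bounded_orbit hgap (V := fun n i => ((V n i : ℝ) : ℂ))
    (memℓp_infty_of_forall_norm_le fun n => (pi_norm_le_iff_of_nonneg
      ((norm_nonneg _).trans (hD 0))).2 fun i => by
        rw [Complex.norm_real]
        exact (PiLp.norm_apply_le (V n) i).trans (hD n))
    (fun n => by rw [complexification_ofReal, hV]) n
  ext i
  simpa using congrFun hzero i

theorem IsHyperbolic.exists_isGreenFunction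
    {A : EuclideanSpace ℝ (Fin k) →L[ℝ] EuclideanSpace ℝ (Fin k)} {r : ℝ}
    (hA : IsHyperbolic A r) : ∃ K g, IsGreenFunction A r K g := by
  obtain ⟨K, hK, g, hg, hstep⟩ := exists_norm_le_of_greenSubmodule_eq_top
    (zero_le_one.trans hA.one_lt.le) hA.greenSubmodule_eq_top
  exact ⟨K, g, hA.one_lt, hK, hg, hstep, fun _ => hA.eq_zero_of_bounded_orbit⟩

end Complexification

section Convolution

variable {𝕜 E : Type*} [NontriviallyNormedField 𝕜] [NormedAddCommGroup E] [NormedSpace 𝕜 E]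

theorem summable_zpow_neg_abs {q : ℝ} (hq : 1 < q) : Summable fun j : ℤ => q ^ (-|j|) := by
  have hgeom : Summable fun n : ℕ => q⁻¹ ^ n :=
    summable_geometric_of_lt_one (by positivity) (inv_lt_one_of_one_lt₀ hq)
  exact .of_nat_of_neg (hgeom.congr fun n => (zpow_neg_abs_natCast q n).symm)
    (hgeom.congr fun n => by rw [abs_neg, zpow_neg_abs_natCast])

theorem hasSum_zpow_neg_abs_sub {q : ℝ} (hq : 1 < q) (n : ℤ) :
    HasSum (fun j : ℤ => q ^ (-|n - 1 - j|)) (∑' j : ℤ, q ^ (-|j|)) :=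
  (Equiv.subLeft (n - 1)).hasSum_iff (f := fun j : ℤ => q ^ (-|j|)).2
    (summable_zpow_neg_abs hq).hasSum

theorem memℓp_infty_succ_sub_apply {V : ℤ → E} (A : E →L[𝕜] E) (hV : Memℓp V ∞) :
    Memℓp (fun n => V (n + 1) - A (V n)) ∞ := by
  obtain ⟨C, hC⟩ := exists_forall_norm_le_of_memℓp_infty hV
  exact memℓp_infty_of_forall_norm_le fun n =>
    norm_sub_le_of_le (hC (n + 1)) (A.le_opNorm_of_le (hC n))

namespace IsGreenFunction

variable {A : E →L[𝕜] E} {r K : ℝ} {g : ℤ → E →L[𝕜] E}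

theorem pos_rate (hg : IsGreenFunction A r K g) : 0 < r :=
  one_pos.trans hg.one_lt

theorem norm_apply_le (hg : IsGreenFunction A r K g) {e : E} {C : ℝ} (he : ‖e‖ ≤ C) (n : ℤ) :
    ‖g n e‖ ≤ K * r ^ (-|n|) * C :=
  (g n).le_of_opNorm_le_of_le (hg.norm_le n) he

theorem summable [CompleteSpace E] (hg : IsGreenFunction A r K g) {H : ℤ → E} (hH : Memℓp H ∞)
    (n : ℤ) : Summable fun j => g (n - 1 - j) (H j) := by
  obtain ⟨C, hC⟩ := exists_forall_norm_le_of_memℓp_infty hH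
  exact .of_norm_bounded
    (((hasSum_zpow_neg_abs_sub hg.one_lt n).mul_left K).mul_right C).summable
    fun j => hg.norm_apply_le (hC j) _

theorem memℓp_convolution (hg : IsGreenFunction A r K g) {H : ℤ → E} (hH : Memℓp H ∞) :
    Memℓp (fun n => ∑' j, g (n - 1 - j) (H j)) ∞ := by
  obtain ⟨C, hC⟩ := exists_forall_norm_le_of_memℓp_infty hH
  exact memℓp_infty_of_forall_norm_le fun n =>
    tsum_of_norm_bounded (((hasSum_zpow_neg_abs_sub hg.one_lt n).mul_left K).mul_right C)
      fun j => hg.norm_apply_le (hC j) _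

theorem convolution_step [CompleteSpace E] (hg : IsGreenFunction A r K g) {H : ℤ → E}
    (hH : Memℓp H ∞) (n : ℤ) :
    ∑' j, g (n + 1 - 1 - j) (H j) - A (∑' j, g (n - 1 - j) (H j)) = H n := by
  have hstep : ∀ j, g (n + 1 - 1 - j) (H j) - A (g (n - 1 - j) (H j)) = if j = n then H j else 0 :=
    fun j => by
      rw [show n + 1 - 1 - j = n - 1 - j + 1 by ring, hg.step]
      exact if_congr (by omega) rfl rfl
  have hsum := hg.summable hH n
  rw [A.map_tsum hsum, ← (hg.summable hH (n + 1)).tsum_sub (hsum.mapL A), tsum_congr hstep,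
    tsum_ite_eq]

theorem eq_convolution [CompleteSpace E] (hg : IsGreenFunction A r K g) {V : ℤ → E}
    (hV : Memℓp V ∞) (n : ℤ) : V n = ∑' j, g (n - 1 - j) (V (j + 1) - A (V j)) := by
  have hH := memℓp_infty_succ_sub_apply A hV
  refine sub_eq_zero.1 (hg.eq_zero (fun n => V n - ∑' j, g (n - 1 - j) (V (j + 1) - A (V j)))
    (hV.sub (hg.memℓp_convolution hH)) (fun n => ?_) n)
  rw [sub_eq_iff_eq_add.1 (hg.convolution_step hH n), map_sub]
  abel

theorem bijective_differenceOp [CompleteSpace E] (hg : IsGreenFunction A r K g)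
    {B : BddSeq (E →L[𝕜] E)} (hB : ∀ n, B n = A) : Function.Bijective (differenceOp B) := by
  constructor
  · refine (injective_iff_map_eq_zero _).2 fun V hV => lp.ext <| funext fun n =>
      hg.eq_zero V (lp.memℓp V) (fun n => ?_) n
    rw [← hB n]
    exact sub_eq_zero.1 (congrFun (congrArg Subtype.val hV) n)
  · intro H
    refine ⟨⟨_, hg.memℓp_convolution (lp.memℓp H)⟩, lp.ext <| funext fun n => ?_⟩
    rw [differenceOp_apply, hB]
    exact hg.convolution_step (lp.memℓp H) n

theorem norm_le_of_hasSum [CompleteSpace E] (hg : IsGreenFunction A r K g) {V : ℤ → E}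
    (hV : Memℓp V ∞) {b c : ℤ → ℝ} {s : ℝ} (hb : ∀ n, ‖V (n + 1) - A (V n)‖ ≤ b n) (n : ℤ)
    (hc : HasSum c s) (hbc : ∀ j, r ^ (-|j|) * b (n - 1 - j) ≤ c j) : ‖V n‖ ≤ K * s := by
  rw [hg.eq_convolution hV n]
  refine tsum_of_norm_bounded (((Equiv.subLeft (n - 1)).hasSum_iff.2 hc).mul_left K) fun j => ?_
  have hj := hbc (n - 1 - j)
  rw [sub_sub_cancel] at hj
  calc ‖g (n - 1 - j) (V (j + 1) - A (V j))‖ ≤ K * (r ^ (-|n - 1 - j|) * b j) := by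
        rw [← mul_assoc]
        exact hg.norm_apply_le (hb j) _
    _ ≤ K * c (n - 1 - j) := mul_le_mul_of_nonneg_left hj hg.pos.le

end IsGreenFunction

end Convolution

section Decay

variable {𝕜 E : Type*} [NontriviallyNormedField 𝕜] [NormedAddCommGroup E] [NormedSpace 𝕜 E]
  [CompleteSpace E]

theorem le_two_mul_of_forall_bound_improves {ι : Type*} {b : ι → ℝ} {D : ℝ}
    (hb : BddAbove (Set.range b)) (himp : ∀ S, (∀ n, b n ≤ S) → ∀ n, b n ≤ D + S / 2) (n : ι) :
    b n ≤ 2 * D := by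
  have : Nonempty ι := ⟨n⟩
  have hsup : (⨆ n, b n) ≤ D + (⨆ n, b n) / 2 := ciSup_le (himp _ (le_ciSup hb))
  linarith [le_ciSup hb n]

theorem abs_le_abs_sub_one_sub_add (n j : ℤ) : |n| ≤ |n - 1 - j| + |j| + 1 := by
  grind

theorem zpow_neg_abs_sub_le {q : ℝ} (hq : 1 ≤ q) (n j : ℤ) :
    q ^ (-|n - 1 - j|) ≤ q ^ |j| * q * q ^ (-|n|) := by
  have hq₀ : q ≠ 0 := (one_pos.trans_le hq).ne'
  rw [← zpow_add_one₀ hq₀, ← zpow_add₀ hq₀]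
  exact zpow_le_zpow_right₀ hq (by linarith [abs_le_abs_sub_one_sub_add n j])

theorem exists_nonneg_forall_or_le_mul {ι : Type*} {f w : ι → ℝ} {P : ι → Prop}
    (hw : ∀ n, 0 < w n) (hP : ∀ᶠ n in cofinite, P n) : ∃ c, 0 ≤ c ∧ ∀ n, P n ∨ f n ≤ c * w n := by
  obtain ⟨c, hc⟩ := (Set.Finite.image (fun n => f n / w n) hP).bddAbove
  refine ⟨max c 0, le_max_right _ _, fun n => or_iff_not_imp_left.2 fun hn => ?_⟩
  rw [← div_le_iff₀ (hw n)]
  exact (hc ⟨n, hn, rfl⟩).trans (le_max_left _ _)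

namespace IsGreenFunction

variable {A : E →L[𝕜] E} {r K ρ : ℝ} {g : ℤ → E →L[𝕜] E}

theorem norm_le_of_slowly_varying_weight (hg : IsGreenFunction A r K g) (hρ : 0 < ρ)
    (hρr : ρ < r) {w : ℤ → ℝ} (hw : ∀ n j, w (n - 1 - j) ≤ ρ ^ |j| * ρ * w n) {V : ℤ → E}
    (hV : Memℓp V ∞) {b : ℝ} (hb₀ : 0 ≤ b) (hb : ∀ n, ‖V (n + 1) - A (V n)‖ ≤ b * w n) (n : ℤ) :
    ‖V n‖ ≤ K * ρ * (∑' j : ℤ, (r / ρ) ^ (-|j|)) * b * w n := by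
  have hr := hg.pos_rate
  refine (hg.norm_le_of_hasSum hV hb n (c := fun j => b * ρ * w n * (r / ρ) ^ (-|j|))
    ((summable_zpow_neg_abs ((one_lt_div hρ).2 hρr)).hasSum.mul_left _) fun j => ?_).trans_eq
    (by ring)
  calc r ^ (-|j|) * (b * w (n - 1 - j)) ≤ r ^ (-|j|) * (b * (ρ ^ |j| * ρ * w n)) := by
        gcongr
        exact hw n j
    _ = b * ρ * w n * (r / ρ) ^ (-|j|) := by
        rw [div_zpow, zpow_neg ρ, div_inv_eq_mul]
        ring

theorem norm_le_of_fast_decay (hg : IsGreenFunction A r K g) {τ : ℝ} (hτ : r < τ) {c : ℝ}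
    (hc : 0 ≤ c) {V : ℤ → E} (hV : Memℓp V ∞)
    (hstep : ∀ n, ‖V (n + 1) - A (V n)‖ ≤ c * τ ^ (-|n|)) (n : ℤ) :
    ‖V n‖ ≤ K * (c * r * ∑' j : ℤ, (τ / r) ^ (-|j|)) * r ^ (-|n|) := by
  have hr := hg.pos_rate
  have hτ₀ : 0 < τ := hr.trans hτ
  refine (hg.norm_le_of_hasSum hV hstep n
    (c := fun j => c * r * r ^ (-|n|) * (τ / r) ^ (-|n - 1 - j|))
    ((hasSum_zpow_neg_abs_sub ((one_lt_div hr).2 hτ) n).mul_left _) fun j => ?_).trans_eq (by ring)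
  have hj : r ^ (-|j|) ≤ r ^ |n - 1 - j| * r * r ^ (-|n|) := by
    simpa only [sub_sub_cancel] using zpow_neg_abs_sub_le hg.one_lt.le n (n - 1 - j)
  calc r ^ (-|j|) * (c * τ ^ (-|n - 1 - j|))
      ≤ r ^ |n - 1 - j| * r * r ^ (-|n|) * (c * τ ^ (-|n - 1 - j|)) := by gcongr
    _ = c * r * r ^ (-|n|) * (τ / r) ^ (-|n - 1 - j|) := by
        rw [div_zpow, zpow_neg r |n - 1 - j|, div_inv_eq_mul]
        ring

/-- The weight `ρ ^ (-|n|) + η` instead of `ρ ^ (-|n|)` makes the weighted norm of a bounded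
sequence finite, so that the perturbation `ε * ‖V n‖` can be absorbed. -/
theorem exists_norm_le_mul_zpow_add (hg : IsGreenFunction A r K g) (hρ : 1 < ρ) (hρr : ρ < r) :
    ∃ ε > 0, ∀ c, 0 ≤ c → ∃ D, ∀ V : ℤ → E, Memℓp V ∞ →
      (∀ n, ‖V (n + 1) - A (V n)‖ ≤ c * ρ ^ (-|n|) + ε * ‖V n‖) →
      ∀ η > 0, ∀ n, ‖V n‖ ≤ D * (ρ ^ (-|n|) + η) := by
  have hρ₀ : 0 < ρ := one_pos.trans hρ
  have hr := hg.pos_rate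
  let S := K * ρ * ∑' j : ℤ, (r / ρ) ^ (-|j|)
  have hS : 0 < S := mul_pos (mul_pos hg.pos hρ₀)
    ((summable_zpow_neg_abs ((one_lt_div hρ₀).2 hρr)).tsum_pos (fun j => by positivity) 0 (by simp))
  refine ⟨1 / (2 * S), by positivity, fun c hc => ⟨2 * (S * c), fun V hV hstep η hη n => ?_⟩⟩
  let w : ℤ → ℝ := fun n => ρ ^ (-|n|) + η
  have hw₀ : ∀ n, 0 < w n := fun n => by positivity
  have hw : ∀ n j, w (n - 1 - j) ≤ ρ ^ |j| * ρ * w n := fun n j => by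
    have hone : 1 ≤ ρ ^ |j| * ρ := one_le_mul_of_one_le_of_one_le
      (one_le_zpow₀ hρ.le (abs_nonneg j)) hρ.le
    rw [mul_add]
    exact add_le_add (zpow_neg_abs_sub_le hρ.le n j) (le_mul_of_one_le_left hη.le hone)
  obtain ⟨C, hC⟩ := exists_forall_norm_le_of_memℓp_infty hV
  rw [← div_le_iff₀ (hw₀ n)]
  refine le_two_mul_of_forall_bound_improves (b := fun n => ‖V n‖ / w n)
    ⟨C / η, Set.forall_mem_range.2 fun n => div_le_div₀ ((norm_nonneg _).trans (hC n)) (hC n) hη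
      (le_add_of_nonneg_left (by positivity))⟩ (fun T hT n => ?_) n
  have hT₀ : 0 ≤ T := (div_nonneg (norm_nonneg _) (hw₀ 0).le).trans (hT 0)
  rw [div_le_iff₀ (hw₀ n)]
  refine (hg.norm_le_of_slowly_varying_weight hρ₀ hρr hw hV (b := c + 1 / (2 * S) * T)
    (by positivity) (fun n => (hstep n).trans ?_) n).trans_eq ?_
  · rw [add_mul, mul_assoc _ T]
    gcongr
    · exact le_add_of_nonneg_right hη.le
    · exact (div_le_iff₀ (hw₀ n)).1 (hT n)
  · change S * (c + 1 / (2 * S) * T) * w n = _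
    field_simp

theorem exists_norm_le_mul_zpow (hg : IsGreenFunction A r K g) (hρ : 1 < ρ) (hρr : ρ < r) :
    ∃ ε > 0, ∀ c, 0 ≤ c → ∃ D, ∀ V : ℤ → E, Memℓp V ∞ →
      (∀ n, ‖V (n + 1) - A (V n)‖ ≤ c * ρ ^ (-|n|) + ε * ‖V n‖) →
      ∀ n, ‖V n‖ ≤ D * ρ ^ (-|n|) := by
  obtain ⟨ε, hε, hdecay⟩ := hg.exists_norm_le_mul_zpow_add hρ hρr
  refine ⟨ε, hε, fun c hc => (hdecay c hc).imp fun D hD V hV hstep n => ?_⟩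
  have hlim : Tendsto (fun η => D * (ρ ^ (-|n|) + η)) (𝓝[>] 0) (𝓝 (D * (ρ ^ (-|n|) + 0))) :=
    ((tendsto_id.const_add _).const_mul _).mono_left nhdsWithin_le_nhds
  rw [add_zero] at hlim
  exact ge_of_tendsto hlim (eventually_mem_nhdsWithin.mono fun η hη => hD V hV hstep η hη n)

/-- The first pass gives decay with a rate `ρ < r`; since `r < ρ ^ 2`, the quadratic error then
decays faster than the Green function, which gives the full rate `r`. -/
theorem exists_decay_of_sq_le (hg : IsGreenFunction A r K g) {c : ℝ} (hc : 0 ≤ c) :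
    ∃ ε > 0, ∀ V : ℤ → E, Memℓp V ∞ → (∀ n, ‖V (n + 1) - A (V n)‖ ≤ c * ‖V n‖ ^ 2) →
      (∀ᶠ n in cofinite, ‖V n‖ ≤ ε) → ∃ D > 0, ∀ n, ‖V n‖ ≤ D * r ^ (-|n|) := by
  have hr := hg.one_lt
  have hr₀ := hg.pos_rate
  obtain ⟨ρ, hρ, hρr⟩ := exists_between (show √r < r from
    (Real.sqrt_lt' hr₀).2 (by nlinarith))
  have hρ₁ : 1 < ρ := (Real.lt_sqrt_of_sq_lt (by linarith)).trans hρ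
  have hρ₂ : r < ρ ^ 2 := (Real.sqrt_lt' (one_pos.trans hρ₁)).1 hρ
  obtain ⟨ε, hε, hslow⟩ := hg.exists_norm_le_mul_zpow hρ₁ hρr
  refine ⟨ε / (c + 1), by positivity, fun V hV hstep hsmall => ?_⟩
  obtain ⟨c', hc', hsplit⟩ := exists_nonneg_forall_or_le_mul (f := fun n => c * ‖V n‖ ^ 2)
    (w := fun n => ρ ^ (-|n|)) (fun n => by positivity) hsmall
  obtain ⟨D, hD⟩ := hslow c' hc'
  have hdecay := hD V hV fun n => (hstep n).trans <| by
    rcases hsplit n with hn | hn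
    · refine le_add_of_nonneg_of_le (by positivity) ?_
      rw [le_div_iff₀ (by positivity)] at hn
      rw [sq, ← mul_assoc]
      gcongr
      linarith [norm_nonneg (V n)]
    · exact le_add_of_le_of_nonneg hn (by positivity)
  have hfast := hg.norm_le_of_fast_decay hρ₂ (c := c * D ^ 2) (by positivity) hV fun n => by
    refine (hstep n).trans ?_
    rw [← zpow_natCast ρ, zpow_comm, zpow_natCast, mul_assoc, ← mul_pow]
    gcongr
    exact hdecay n
  exact ⟨_, lt_max_of_lt_right one_pos, fun n => (hfast n).trans
    (mul_le_mul_of_nonneg_right (le_max_left _ 1) (by positivity))⟩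

end IsGreenFunction

end Decay

section APrioriBound

variable {𝕜 E : Type*} [NontriviallyNormedField 𝕜] [NormedAddCommGroup E] [NormedSpace 𝕜 E]

/-- A quantitative form of the injectivity of the difference operator of `B`: a bounded sequence
with defect at most `h` has norm at most `K * h`. -/
def HasAPrioriBound (B : ℤ → E →L[𝕜] E) (K : ℝ) : Prop :=
  ∀ V : ℤ → E, Memℓp V ∞ → ∀ h, (∀ n, ‖V (n + 1) - B n (V n)‖ ≤ h) → ∀ n, ‖V n‖ ≤ K * h

theorem exists_hasAPrioriBound [CompleteSpace E] {B : BddSeq (E →L[𝕜] E)}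
    (hB : Function.Bijective (differenceOp B)) : ∃ K > 0, HasAPrioriBound B K := by
  obtain ⟨K, hK, hle⟩ := exists_norm_le_mul_norm_differenceOp hB
  refine ⟨K, hK, fun V hV h hVh n => ?_⟩
  calc ‖V n‖ ≤ ‖(⟨V, hV⟩ : BddSeq E)‖ := lp.norm_apply_le_norm ENNReal.top_ne_zero ⟨V, hV⟩ n
    _ ≤ K * ‖differenceOp B ⟨V, hV⟩‖ := hle _
    _ ≤ K * h := by
        gcongr
        exact lp.norm_le_of_forall_le ((norm_nonneg _).trans (hVh 0)) hVh

namespace HasAPrioriBound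

variable {A : E →L[𝕜] E} {B : ℤ → E →L[𝕜] E} {K κ : ℝ}

theorem norm_le_of_perturbation (hB : HasAPrioriBound B K) (hκK : κ * (2 * K) ≤ 1) (hκ : 0 ≤ κ)
    {V : ℤ → E} (hV : Memℓp V ∞) {h : ℝ} (hVh : ∀ n, ‖V (n + 1) - B n (V n)‖ ≤ h + κ * ‖V n‖)
    (n : ℤ) : ‖V n‖ ≤ 2 * (K * h) := by
  refine le_two_mul_of_forall_bound_improves (memℓp_infty_iff.1 hV) (fun S hS n => ?_) n
  have hS₀ : 0 ≤ S := (norm_nonneg _).trans (hS 0)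
  refine (hB V hV (h + κ * S) (fun n => (hVh n).trans ?_) n).trans ?_
  · gcongr
    exact hS n
  · nlinarith

theorem norm_le_of_forward (hA : HasAPrioriBound (fun _ => A) K) (hκK : κ * (2 * K) ≤ 1)
    (hκ : 0 ≤ κ) {y : ℕ → E} (hy : Memℓp y ∞)
    (hstep : ∀ j, ‖y (j + 1) - A (y j)‖ ≤ κ * ‖y j‖) (j : ℕ) : ‖y j‖ ≤ 2 * (K * ‖y 0‖) := by
  let V : ℤ → E := Int.rec y fun _ => 0
  obtain ⟨C, hC⟩ := exists_forall_norm_le_of_memℓp_infty hy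
  have hV : Memℓp V ∞ := memℓp_infty_of_forall_norm_le (C := C) <|
    Int.rec hC fun _ => norm_zero.trans_le ((norm_nonneg _).trans (hC 0))
  refine hA.norm_le_of_perturbation hκK hκ hV (h := ‖y 0‖) ?_ j
  rintro (j | _ | j)
  · exact le_add_of_nonneg_of_le (norm_nonneg _) (hstep j)
  · change ‖y 0 - A 0‖ ≤ ‖y 0‖ + κ * ‖(0 : E)‖
    rw [map_zero, sub_zero, norm_zero, mul_zero, add_zero]
  · change ‖0 - A 0‖ ≤ ‖y 0‖ + κ * ‖(0 : E)‖
    simp only [map_zero, sub_zero, norm_zero, mul_zero, add_zero, norm_nonneg]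

theorem norm_le_of_backward (hA : HasAPrioriBound (fun _ => A) K) (hκK : κ * (2 * K) ≤ 1)
    (hκ : 0 ≤ κ) {y : ℕ → E} (hy : Memℓp y ∞)
    (hstep : ∀ j, ‖y j - A (y (j + 1))‖ ≤ κ * ‖y (j + 1)‖) (j : ℕ) :
    ‖y j‖ ≤ 2 * (K * (‖A‖ * ‖y 0‖)) := by
  let V : ℤ → E := Int.rec (fun _ => 0) y
  obtain ⟨C, hC⟩ := exists_forall_norm_le_of_memℓp_infty hy
  have hV : Memℓp V ∞ := memℓp_infty_of_forall_norm_le (C := C) <|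
    Int.rec (fun _ => norm_zero.trans_le ((norm_nonneg _).trans (hC 0))) hC
  refine hA.norm_le_of_perturbation hκK hκ hV (h := ‖A‖ * ‖y 0‖) ?_ (Int.negSucc j)
  rintro (j | _ | j)
  · change ‖0 - A 0‖ ≤ ‖A‖ * ‖y 0‖ + κ * ‖(0 : E)‖
    rw [map_zero, sub_zero, norm_zero]
    positivity
  · change ‖0 - A (y 0)‖ ≤ ‖A‖ * ‖y 0‖ + κ * ‖y 0‖
    rw [zero_sub, norm_neg]
    exact le_add_of_le_of_nonneg (A.le_opNorm _) (by positivity)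
  · exact le_add_of_nonneg_of_le (by positivity) (hstep j)

end HasAPrioriBound

end APrioriBound

section BoundedSolutions

variable {𝕜 E : Type*} [NormedField 𝕜] [NormedAddCommGroup E] [NormedSpace 𝕜 E]

/-- The subspace of the initial values `V 0` of the bounded forward solutions of
`V (j + 1) = B j (V j)`. -/
def forwardBounded (B : ℕ → E →L[𝕜] E) : Submodule 𝕜 E where
  carrier := {v | ∃ V : ℕ → E, Memℓp V ∞ ∧ V 0 = v ∧ ∀ j, V (j + 1) = B j (V j)}
  zero_mem' := ⟨0, zero_memℓp, rfl, fun j => (map_zero (B j)).symm⟩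
  add_mem' := by
    rintro _ _ ⟨V, hV, rfl, hBV⟩ ⟨W, hW, rfl, hBW⟩
    exact ⟨V + W, hV.add hW, rfl, fun j => by simp only [Pi.add_apply, hBV, hBW, map_add]⟩
  smul_mem' := by
    rintro c _ ⟨V, hV, rfl, hBV⟩
    exact ⟨c • V, hV.const_smul c, rfl, fun j => by simp only [Pi.smul_apply, hBV, map_smul]⟩

/-- The subspace of the initial values `V 0` of the bounded backward solutions of
`B j (V (j + 1)) = V j`; the index `j` counts the steps backwards in time. -/
def backwardBounded (B : ℕ → E →L[𝕜] E) : Submodule 𝕜 E where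
  carrier := {v | ∃ V : ℕ → E, Memℓp V ∞ ∧ V 0 = v ∧ ∀ j, B j (V (j + 1)) = V j}
  zero_mem' := ⟨0, zero_memℓp, rfl, fun j => map_zero (B j)⟩
  add_mem' := by
    rintro _ _ ⟨V, hV, rfl, hBV⟩ ⟨W, hW, rfl, hBW⟩
    exact ⟨V + W, hV.add hW, rfl, fun j => by simp only [Pi.add_apply, map_add, hBV, hBW]⟩
  smul_mem' := by
    rintro c _ ⟨V, hV, rfl, hBV⟩
    exact ⟨c • V, hV.const_smul c, rfl, fun j => by simp only [Pi.smul_apply, map_smul, hBV]⟩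

end BoundedSolutions

section Surjectivity

variable {𝕜 E : Type*} [NontriviallyNormedField 𝕜] [NormedAddCommGroup E] [NormedSpace 𝕜 E]

theorem exists_differenceOp_eq_single {B : BddSeq (E →L[𝕜] E)} {n : ℤ}
    (hB : forwardBounded (fun j => B (n + 1 + j)) ⊔
      backwardBounded (fun j => B (n + 1 - (j + 1 : ℕ))) = ⊤) (e : E) :
    ∃ V, differenceOp B V = lp.single ∞ n e := by
  obtain ⟨_, ⟨V, hV, rfl, hBV⟩, _, ⟨W, hW, rfl, hBW⟩, rfl⟩ :=
    Submodule.mem_sup.1 (hB ▸ Submodule.mem_top : e ∈ _)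
  obtain ⟨C, hC⟩ := exists_forall_norm_le_of_memℓp_infty hV
  obtain ⟨D, hD⟩ := exists_forall_norm_le_of_memℓp_infty hW
  let U : ℤ → E := Int.rec V fun j => -W (j + 1)
  have hU : ∀ i, ‖U i‖ ≤ max C D := Int.rec (fun j => (hC j).trans (le_max_left _ _))
    fun j => (norm_neg _).trans_le ((hD _).trans (le_max_right _ _))
  have hstep : ∀ i, U (i + 1) - B (n + 1 + i) (U i) = if i = -1 then V 0 + W 0 else 0 := by
    rintro (j | _ | j)
    · rw [if_neg (by simp)]
      exact sub_eq_zero.2 (hBV j)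
    · rw [if_pos (show Int.negSucc 0 = -1 from rfl), ← hBW 0]
      exact (congrArg (V 0 - ·) (map_neg _ _)).trans (sub_neg_eq_add _ _)
    · rw [if_neg (by omega)]
      exact sub_eq_zero.2 ((congrArg Neg.neg (hBW (j + 1)).symm).trans (map_neg _ _).symm)
  refine ⟨⟨fun i => U (i - (n + 1)), memℓp_infty_of_forall_norm_le fun i => hU _⟩,
    lp.ext <| funext fun i => ?_⟩
  have hi := hstep (i - (n + 1))
  rw [add_sub_cancel, sub_add_eq_add_sub] at hi
  rw [differenceOp_apply, lp.single_apply, hi, Pi.single_apply]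
  exact if_congr (by omega) rfl rfl

theorem surjective_differenceOp_of_sup_eq_top [CompleteSpace E] {A B : BddSeq (E →L[𝕜] E)}
    (hA : Function.Bijective (differenceOp A))
    (hBA : Tendsto (fun n => B n - A n) cofinite (𝓝 0))
    (hB : ∀ n : ℤ, forwardBounded (fun j => B (n + j)) ⊔
      backwardBounded (fun j => B (n - (j + 1 : ℕ))) = ⊤) :
    Function.Surjective (differenceOp B) := by
  obtain ⟨B', s, hB', hs⟩ := exists_bijective_differenceOp_eq_off_finset hA hBA
  intro H
  obtain ⟨V, rfl⟩ := hB'.2 H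
  choose W hW using fun n => exists_differenceOp_eq_single (hB (n + 1))
  have hdiff := eq_sum_single (V := differenceOp B' V - differenceOp B V) (s := s) fun n hn => by
    simp only [lp.coeFn_sub, Pi.sub_apply, differenceOp_apply, hs n hn, sub_self]
  refine ⟨V + ∑ j ∈ s, W j ((differenceOp B' V - differenceOp B V) j), ?_⟩
  rw [map_add, map_sum, Finset.sum_congr rfl fun j _ => hW j _, ← hdiff, add_sub_cancel]

end Surjectivity

section TangentSpaces

variable {E : Type*} [NormedAddCommGroup E]

theorem memℓp_infty_of_forall_norm_add_le {V : ℕ → E} {j₀ : ℕ} {C : ℝ}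
    (hV : ∀ j, ‖V (j₀ + j)‖ ≤ C) : Memℓp V ∞ :=
  memℓp_infty <| Filter.IsBoundedUnder.bddAbove_range <| isBoundedUnder_of_eventually_le <|
    (eventually_ge_atTop j₀).mono fun j hj => by
      simpa only [Nat.add_sub_cancel' hj] using hV (j - j₀)

theorem memℓp_infty_sub_of_forall_norm_lt {y z : ℕ → E} {ε : ℝ} (hy : ∀ j, ‖y j‖ < ε)
    (hz : ∀ j, ‖z j‖ < ε) : Memℓp (fun j => y j - z j) ∞ :=
  memℓp_infty_of_forall_norm_le fun j => norm_sub_le_of_le (hy j).le (hz j).le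

variable [NormedSpace ℝ E]

theorem norm_deriv_le_mul_of_eventually {f g : ℝ → E} {f' g' : E} {c t₀ : ℝ}
    (hf : HasDerivAt f f' t₀) (hg : HasDerivAt g g' t₀)
    (h : ∀ᶠ t in 𝓝 t₀, ‖f t - f t₀‖ ≤ c * ‖g t - g t₀‖) : ‖f'‖ ≤ c * ‖g'‖ := by
  refine le_of_tendsto_of_tendsto (hasDerivAt_iff_tendsto_slope.1 hf).norm
    ((hasDerivAt_iff_tendsto_slope.1 hg).norm.const_mul c) ?_
  refine (h.filter_mono nhdsWithin_le_nhds).mono fun t ht => ?_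
  simp only [slope_def_module, norm_smul, mul_left_comm c]
  gcongr

theorem exists_norm_sub_sub_le {F : E → E} {x : E} (hF : ContDiffAt ℝ 1 F x) {κ : ℝ}
    (hκ : 0 < κ) : ∃ ε > 0, ∀ y z, ‖y - x‖ < ε → ‖z - x‖ < ε →
      ‖F y - F z - fderiv ℝ F x (y - z)‖ ≤ κ * ‖y - z‖ := by
  have hlittle := (hF.hasStrictFDerivAt one_ne_zero).isLittleO.def hκ
  rw [nhds_prod_eq, Metric.nhds_basis_ball.prod_self.eventually_iff] at hlittle
  obtain ⟨ε, hε, hle⟩ := hlittle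
  exact ⟨ε, hε, fun y z hy hz =>
    hle (x := (y, z)) ⟨mem_ball_iff_norm.2 hy, mem_ball_iff_norm.2 hz⟩⟩

/-- A curve in `W^s(0)` gives two forward orbits which stay close to the equilibrium, so that their
difference is bounded by a multiple of its initial value; dividing by `t` bounds the derivative. -/
theorem stableTangentSpace_le {F : E → E} (hF : ContDiff ℝ 1 F) {K : ℝ} (hK : 0 < K)
    (hA : HasAPrioriBound (fun _ => fderiv ℝ F 0) K) (p : E) :
    stableTangentSpace F p ≤ forwardBounded fun j => fderiv ℝ F (F^[j] p) := by
  refine Submodule.span_le.2 ?_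
  rintro v ⟨γ, τ, hτ, rfl, hγ, -, hunif⟩
  obtain ⟨ε, hε, hloc⟩ := exists_norm_sub_sub_le (hF.contDiffAt (x := 0)) (κ := 1 / (2 * K))
    (by positivity)
  simp only [sub_zero] at hloc
  let V : ℕ → E := fun j => fderiv ℝ F^[j] (γ 0) v
  have hdiff : ∀ j, Differentiable ℝ F^[j] := (hF.differentiable one_ne_zero).iterate
  have hV : ∀ j, HasDerivAt (fun t => F^[j] (γ t)) (V j) 0 := fun j =>
    (hdiff j (γ 0)).hasFDerivAt.comp_hasDerivAt 0 hγ
  have hstep : ∀ j, V (j + 1) = fderiv ℝ F (F^[j] (γ 0)) (V j) := fun j => by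
    simp only [V, Function.iterate_succ', fderiv_comp _ (hF.differentiable one_ne_zero _)
      (hdiff j _), ContinuousLinearMap.comp_apply]
  obtain ⟨j₀, hj₀⟩ := eventually_atTop.1 (Metric.tendstoUniformlyOn_iff.1 hunif ε hε)
  have hsmall : ∀ t ∈ Set.Ioo (-τ) τ, ∀ j, ‖F^[j₀ + j] (γ t)‖ < ε := fun t ht j => by
    simpa only [dist_zero_left] using hj₀ (j₀ + j) (Nat.le_add_right _ _) t ht
  have h₀ : (0 : ℝ) ∈ Set.Ioo (-τ) τ := ⟨neg_lt_zero.2 hτ, hτ⟩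
  refine ⟨V, memℓp_infty_of_forall_norm_add_le (j₀ := j₀) (C := 2 * K * ‖V j₀‖) fun j => ?_,
    by simp [V], hstep⟩
  refine norm_deriv_le_mul_of_eventually (hV _) (hV _) ?_
  filter_upwards [Ioo_mem_nhds h₀.1 h₀.2] with t ht
  rw [mul_assoc]
  refine hA.norm_le_of_forward (κ := 1 / (2 * K)) (one_div_mul_cancel (by positivity)).le
    (by positivity) (memℓp_infty_sub_of_forall_norm_lt (hsmall t ht) (hsmall 0 h₀)) (fun j => ?_) j
  have := hloc _ _ (hsmall t ht j) (hsmall 0 h₀ j)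
  rwa [← Function.iterate_succ_apply' F, ← Function.iterate_succ_apply' F] at this

theorem unstableTangentSpace_le {F : E → E} (hF : ContDiff ℝ 1 F) {K : ℝ} (hK : 0 < K)
    (hA : HasAPrioriBound (fun _ => fderiv ℝ F 0) K) (y : ℕ → E) :
    unstableTangentSpace F y ≤ backwardBounded fun j => fderiv ℝ F (y (j + 1)) := by
  refine Submodule.span_le.2 ?_
  rintro v ⟨Γ, τ, hτ, rfl, hv, hdiff, hΓ, hunif⟩
  obtain ⟨ε, hε, hloc⟩ := exists_norm_sub_sub_le (hF.contDiffAt (x := 0)) (κ := 1 / (2 * K))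
    (by positivity)
  simp only [sub_zero] at hloc
  let V : ℕ → E := fun j => deriv (fun t => Γ t j) 0
  have hV : ∀ j, HasDerivAt (fun t => Γ t j) (V j) 0 := fun j => (hdiff j).hasDerivAt
  have h₀ : (0 : ℝ) ∈ Set.Ioo (-τ) τ := ⟨neg_lt_zero.2 hτ, hτ⟩
  have hstep : ∀ j, fderiv ℝ F (Γ 0 (j + 1)) (V (j + 1)) = V j := fun j => by
    refine ((hF.differentiable one_ne_zero _).hasFDerivAt.comp_hasDerivAt (0 : ℝ)
      (hV (j + 1))).unique ((hV j).congr_of_eventuallyEq ?_)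
    filter_upwards [Ioo_mem_nhds h₀.1 h₀.2] with t ht
    exact (hΓ t ht).1 j
  obtain ⟨j₀, hj₀⟩ := eventually_atTop.1 (Metric.tendstoUniformlyOn_iff.1 hunif ε hε)
  have hsmall : ∀ t ∈ Set.Ioo (-τ) τ, ∀ j, ‖Γ t (j₀ + j)‖ < ε := fun t ht j => by
    simpa only [dist_zero_left] using hj₀ (j₀ + j) (Nat.le_add_right _ _) t ht
  refine ⟨V, memℓp_infty_of_forall_norm_add_le (j₀ := j₀)
    (C := 2 * K * ‖fderiv ℝ F 0‖ * ‖V j₀‖) fun j => ?_, hv.deriv, hstep⟩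
  refine norm_deriv_le_mul_of_eventually (hV _) (hV _) ?_
  filter_upwards [Ioo_mem_nhds h₀.1 h₀.2] with t ht
  rw [mul_assoc, mul_assoc]
  refine hA.norm_le_of_backward (κ := 1 / (2 * K)) (one_div_mul_cancel (by positivity)).le
    (by positivity) (memℓp_infty_sub_of_forall_norm_lt (hsmall t ht) (hsmall 0 h₀)) (fun j => ?_) j
  have := hloc _ _ (hsmall t ht (j + 1)) (hsmall 0 h₀ (j + 1))
  rwa [← add_assoc, (hΓ t ht).1, (hΓ 0 h₀).1] at this

end TangentSpaces

section Windows

variable {E : Type*} [NormedAddCommGroup E] [NormedSpace ℝ E]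

theorem HasAPrioriBound.shift {B : ℤ → E →L[ℝ] E} {K : ℝ} (hB : HasAPrioriBound B K) (c : ℤ) :
    HasAPrioriBound (fun n => B (n - c)) K := by
  intro V hV h hVh n
  obtain ⟨C, hC⟩ := exists_forall_norm_le_of_memℓp_infty hV
  simpa only [sub_add_cancel] using hB (fun n => V (n + c))
    (memℓp_infty_of_forall_norm_le fun n => hC (n + c)) h
    (fun n => by simpa only [add_right_comm, add_sub_cancel_right] using hVh (n + c)) (n - c)

theorem HasAPrioriBound.conj {B B' : ℤ → E →L[ℝ] E} {K : ℝ} (hB : HasAPrioriBound B K)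
    (T : E ≃ₗᵢ[ℝ] E) (hT : ∀ n v, B' n (T v) = T (B n v)) : HasAPrioriBound B' K := by
  intro V hV h hVh n
  obtain ⟨C, hC⟩ := exists_forall_norm_le_of_memℓp_infty hV
  have hB' (n) : T.symm (B' n (V n)) = B n (T.symm (V n)) := by
    rw [LinearIsometryEquiv.symm_apply_eq, ← hT, T.apply_symm_apply]
  simpa only [T.symm.norm_map] using hB (fun n => T.symm (V n))
    (memℓp_infty_of_forall_norm_le fun n => (T.symm.norm_map _).trans_le (hC n)) h
    (fun n => by simpa only [← hB', ← map_sub, T.symm.norm_map] using hVh n) n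

theorem exists_cutoff {l : ℕ} (hl : 0 < l) (n₀ : ℤ) :
    ∃ φ : ℤ → ℝ, φ n₀ = 1 ∧ (∀ n, 0 ≤ φ n) ∧ (∀ n, φ n ≤ 1) ∧
      (∀ n, |φ (n + 1) - φ n| ≤ 1 / l) ∧ ∀ n, l ≤ |n - n₀| → φ n = 0 := by
  have hl' : (0 : ℝ) < l := Nat.cast_pos.2 hl
  refine ⟨fun n => max (1 - |((n - n₀ : ℤ) : ℝ)| / l) 0, ?_, fun n => le_max_right _ _,
    fun n => max_le (sub_le_self _ (by positivity)) zero_le_one, fun n => ?_, fun n hn => ?_⟩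
  · simp only [sub_self, Int.cast_zero, abs_zero, zero_div, sub_zero, zero_le_one, max_eq_left]
  · refine (abs_max_sub_max_le_abs _ _ _).trans ?_
    rw [sub_sub_sub_cancel_left, ← sub_div, abs_div, abs_of_pos hl']
    gcongr
    refine (abs_abs_sub_abs_le_abs_sub _ _).trans_eq ?_
    rw [← Int.cast_sub, show n - n₀ - (n + 1 - n₀) = -1 by ring, Int.cast_neg, Int.cast_one,
      abs_neg, abs_one]
  · refine max_eq_right (sub_nonpos.2 ((one_le_div hl').2 ?_))
    exact_mod_cast hn

theorem HasAPrioriBound.norm_apply_le_of_window {B B' : ℤ → E →L[ℝ] E} {K b ε h S : ℝ} {l : ℕ}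
    {n₀ : ℤ} (hB' : HasAPrioriBound B' K) (hl : 0 < l) (hε : 0 ≤ ε) (hb : ∀ n, ‖B n‖ ≤ b)
    (hBB' : ∀ n, |n - n₀| < l → ‖B n - B' n‖ ≤ ε) {V : ℤ → E} (hV : ∀ n, ‖V n‖ ≤ S)
    (hVh : ∀ n, ‖V (n + 1) - B n (V n)‖ ≤ h) : ‖V n₀‖ ≤ K * (h + 1 / l * (b * S) + ε * S) := by
  obtain ⟨φ, hφ_center, hφ_nonneg, hφ_le_one, hφ_step, hφ_far⟩ := exists_cutoff hl n₀
  have norm_smul_le (n) {v : E} {a : ℝ} (hv : ‖v‖ ≤ a) : ‖φ n • v‖ ≤ a := by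
    rw [norm_smul, Real.norm_of_nonneg (hφ_nonneg n)]
    exact (mul_le_of_le_one_left (norm_nonneg v) (hφ_le_one n)).trans hv
  have hwindow (n) : ‖φ n • (B n - B' n) (V n)‖ ≤ ε * S := by
    rcases lt_or_ge |n - n₀| l with hn | hn
    · exact norm_smul_le n ((B n - B' n).le_of_opNorm_le_of_le (hBB' n hn) (hV n))
    · rw [hφ_far n hn, zero_smul, norm_zero]
      exact mul_nonneg hε ((norm_nonneg _).trans (hV 0))
  have hcutoff := hB' (fun n => φ n • V n)
    (memℓp_infty_of_forall_norm_le fun n => norm_smul_le n (hV n))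
    (h + 1 / l * (b * S) + ε * S) (fun n => ?_) n₀
  · simpa only [hφ_center, one_smul] using hcutoff
  · have hsplit : φ (n + 1) • V (n + 1) - B' n (φ n • V n) = φ (n + 1) • (V (n + 1) - B n (V n))
        + (φ (n + 1) - φ n) • B n (V n) + φ n • (B n - B' n) (V n) := by
      simp only [map_smul, _root_.sub_apply]
      module
    rw [hsplit]
    refine norm_add_le_of_le (norm_add_le_of_le (norm_smul_le _ (hVh n)) ?_) (hwindow n)
    rw [norm_smul]
    gcongr
    exacts [hφ_step n, (B n).le_of_opNorm_le_of_le (hb n) (hV n)]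

theorem hasAPrioriBound_of_windows {B : ℤ → E →L[ℝ] E} {b K ε : ℝ} {l : ℕ} (hl : 0 < l)
    (hε : 0 ≤ ε) (hb : ∀ n, ‖B n‖ ≤ b) (hsmall : K * (b / l + ε) ≤ 1 / 2)
    (hloc : ∀ n₀ : ℤ, ∃ B' : ℤ → E →L[ℝ] E, HasAPrioriBound B' K ∧
      ∀ n, |n - n₀| < l → ‖B n - B' n‖ ≤ ε) : HasAPrioriBound B (2 * K) := by
  intro V hV h hVh n
  rw [mul_assoc]
  refine le_two_mul_of_forall_bound_improves (memℓp_infty_iff.1 hV) (fun S hS n₀ => ?_) n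
  obtain ⟨B', hB', hBB'⟩ := hloc n₀
  have hS₀ : 0 ≤ S := (norm_nonneg _).trans (hS 0)
  calc ‖V n₀‖ ≤ K * (h + 1 / l * (b * S) + ε * S) :=
        hB'.norm_apply_le_of_window hl hε hb hBB' hS hVh
    _ = K * h + K * (b / l + ε) * S := by ring
    _ ≤ K * h + 1 / 2 * S := by gcongr
    _ = K * h + S / 2 := by ring

end Windows

section Taylor

variable {E : Type*} [NormedAddCommGroup E] [NormedSpace ℝ E] {F : E → E} {R : ℝ} {Λ : NNReal}

theorem exists_lipschitzOnWith_fderiv [FiniteDimensional ℝ E] (hF : ContDiff ℝ 2 F) (R : ℝ) :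
    ∃ Λ > 0, LipschitzOnWith Λ (fderiv ℝ F) (Metric.closedBall 0 R) := by
  have : ProperSpace E := FiniteDimensional.proper ℝ E
  have hF' : ContDiff ℝ 1 (fderiv ℝ F) := hF.fderiv_right one_add_one_eq_two.le
  obtain ⟨C, hC⟩ := (isCompact_closedBall (0 : E) R).exists_bound_of_continuousOn
    (hF'.continuous_fderiv one_ne_zero).continuousOn
  refine ⟨C.toNNReal + 1, by positivity, Convex.lipschitzOnWith_of_nnnorm_fderiv_le (𝕜 := ℝ)
    (fun x _ => hF'.differentiable one_ne_zero x) (fun x hx => ?_) (convex_closedBall _ _)⟩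
  exact (NNReal.le_toNNReal_of_coe_le (hC x hx)).trans le_self_add

theorem approximatesLinearOn_closedBall (hF : Differentiable ℝ F)
    (hΛ : LipschitzOnWith Λ (fderiv ℝ F) (Metric.closedBall 0 R)) {z : E} {ρ : NNReal}
    (hz : ‖z‖ + ρ ≤ R) :
    ApproximatesLinearOn F (fderiv ℝ F z) (Metric.closedBall z ρ) (Λ * ρ) := by
  have hsub : Metric.closedBall z ρ ⊆ Metric.closedBall 0 R :=
    Metric.closedBall_subset_closedBall' (by rwa [dist_zero_right, add_comm])
  intro v hv w hw
  refine (convex_closedBall z ρ).norm_image_sub_le_of_norm_fderiv_le' (𝕜 := ℝ)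
    (fun x _ => hF x) (fun x hx => ?_) hw hv
  refine (hΛ.norm_sub_le (hsub hx) (hsub (Metric.mem_closedBall_self ρ.2))).trans ?_
  rw [NNReal.coe_mul]
  gcongr
  exact mem_closedBall_iff_norm.1 hx

theorem norm_map_sub_fderiv_zero_le (hF : Differentiable ℝ F) (hF0 : F 0 = 0)
    (hΛ : LipschitzOnWith Λ (fderiv ℝ F) (Metric.closedBall 0 R)) {x : E} (hx : ‖x‖ ≤ R) :
    ‖F x - fderiv ℝ F 0 x‖ ≤ Λ * ‖x‖ ^ 2 := by
  have hlin := approximatesLinearOn_closedBall hF hΛ (z := 0) (ρ := ‖x‖₊)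
    (by rwa [norm_zero, zero_add]) x (mem_closedBall_zero_iff.2 le_rfl) 0
    (Metric.mem_closedBall_self (norm_nonneg x))
  rwa [hF0, sub_zero, sub_zero, NNReal.coe_mul, mul_assoc, coe_nnnorm, ← pow_two] at hlin

theorem norm_map_add_sub_sub_le (hF : Differentiable ℝ F) (hF0 : F 0 = 0)
    (hΛ : LipschitzOnWith Λ (fderiv ℝ F) (Metric.closedBall 0 R)) {x y : E}
    (hxy : ‖x‖ + ‖y‖ ≤ R) : ‖F (x + y) - F x - F y‖ ≤ Λ * ‖x‖ * ‖y‖ := by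
  have hderiv (t) : HasFDerivAt (fun t => F (x + t) - F t) (fderiv ℝ F (x + t) - fderiv ℝ F t) t :=
    ((hasFDerivAt_comp_add_left x).2 (hF (x + t)).hasFDerivAt).sub (hF t).hasFDerivAt
  have hbound : ∀ t ∈ Metric.closedBall (0 : E) ‖y‖,
      ‖fderiv ℝ F (x + t) - fderiv ℝ F t‖ ≤ Λ * ‖x‖ := fun t ht => by
    have hty : ‖t‖ ≤ ‖y‖ := mem_closedBall_zero_iff.1 ht
    have hxt : x + t ∈ Metric.closedBall (0 : E) R :=
      mem_closedBall_zero_iff.2 ((norm_add_le_of_le le_rfl hty).trans hxy)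
    have htR : t ∈ Metric.closedBall (0 : E) R :=
      mem_closedBall_zero_iff.2 (hty.trans ((le_add_of_nonneg_left (norm_nonneg x)).trans hxy))
    simpa only [add_sub_cancel_right] using hΛ.norm_sub_le hxt htR
  have hmean := (convex_closedBall (0 : E) ‖y‖).norm_image_sub_le_of_norm_hasFDerivWithin_le
    (𝕜 := ℝ) (fun t _ => (hderiv t).hasFDerivWithinAt) hbound
    (Metric.mem_closedBall_self (norm_nonneg y)) (mem_closedBall_zero_iff.2 le_rfl)
  rwa [add_zero, hF0, sub_zero, sub_zero, sub_right_comm] at hmean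

end Taylor

section BoundedOrbits

variable {E : Type*}

theorem IsOrbit.iterate {F : E → E} {U : ℤ → E} (hU : IsOrbit F U) (n : ℤ) (j : ℕ) :
    F^[j] (U n) = U (n + j) := by
  induction j with
  | zero => rw [Nat.cast_zero, add_zero, Function.iterate_zero_apply]
  | succ j ih => rw [Function.iterate_succ_apply', ih, ← hU, Nat.cast_succ, add_assoc]

variable [NormedAddCommGroup E]

theorem IsHomoclinicOrbit.tendsto_cofinite {F : E → E} {U : ℤ → E} (hU : IsHomoclinicOrbit F U) :
    Tendsto U cofinite (𝓝 0) := by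
  rw [Int.cofinite_eq]
  exact hU.2.2.sup hU.2.1

theorem IsOrbit.isHomoclinicOrbit {F : E → E} {U : ℤ → E} (hU : IsOrbit F U)
    (hU₀ : Tendsto U cofinite (𝓝 0)) : IsHomoclinicOrbit F U := by
  rw [Int.cofinite_eq, tendsto_sup] at hU₀
  exact ⟨hU, hU₀.2, hU₀.1⟩

theorem tendsto_cofinite_of_exponential_decay {r D : ℝ} (hr : 1 < r) {U : ℤ → E}
    (hU : ∀ n, ‖U n‖ ≤ D * r ^ (-|n|)) : Tendsto U cofinite (𝓝 0) :=
  squeeze_zero_norm hU <| by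
    simpa only [mul_zero] using (summable_zpow_neg_abs hr).tendsto_cofinite_zero.const_mul D

theorem memℓp_infty_of_tendsto_cofinite {V : ℤ → E} {a : E} (hV : Tendsto V cofinite (𝓝 a)) :
    Memℓp V ∞ :=
  memℓp_infty_iff.2 hV.norm.isBoundedUnder_le.bddAbove_range_of_cofinite

theorem memℓp_infty_comp [ProperSpace E] {E' : Type*} [NormedAddCommGroup E'] {f : E → E'}
    (hf : Continuous f) {V : ℤ → E} (hV : Memℓp V ∞) : Memℓp (fun n => f (V n)) ∞ := by
  obtain ⟨C, hC⟩ := exists_forall_norm_le_of_memℓp_infty hV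
  obtain ⟨C', hC'⟩ := (isCompact_closedBall (0 : E) C).exists_bound_of_continuousOn hf.continuousOn
  exact memℓp_infty_of_forall_norm_le fun n => hC' _ (mem_closedBall_zero_iff.2 (hC n))

end BoundedOrbits

section Fredholm

variable {E : Type*} [NormedAddCommGroup E] [NormedSpace ℝ E] [FiniteDimensional ℝ E]

theorem bijective_differenceOp_of_hasAPrioriBound {A B : BddSeq (E →L[ℝ] E)} {K : ℝ}
    (hA : Function.Bijective (differenceOp A))
    (hBA : Tendsto (fun n => B n - A n) cofinite (𝓝 0)) (hB : HasAPrioriBound (⇑B) K) :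
    Function.Bijective (differenceOp B) := by
  have : CompleteSpace E := FiniteDimensional.complete ℝ E
  have hinj : Function.Injective (differenceOp B) :=
    (injective_iff_map_eq_zero _).2 fun V hV => lp.ext <| funext fun n => by
      have hVn := hB V (lp.memℓp V) 0 (fun n => by
        rw [← differenceOp_apply, hV, lp.coeFn_zero, Pi.zero_apply, norm_zero]) n
      rw [mul_zero] at hVn
      exact norm_le_zero_iff.1 hVn
  exact ⟨hinj, (injective_iff_surjective_differenceOp_of_tendsto hA hBA).1 hinj⟩

/-- The coefficients `DF(W n)` of the variational equation of `F` along a bounded sequence `W`. -/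
noncomputable def variationalCoeff {F : E → E} (hF : ContDiff ℝ 1 F) (W : BddSeq E) :
    BddSeq (E →L[ℝ] E) :=
  have : ProperSpace E := FiniteDimensional.proper ℝ E
  ⟨fun n => fderiv ℝ F (W n), memℓp_infty_comp (hF.continuous_fderiv one_ne_zero) (lp.memℓp W)⟩

theorem variationalCoeff_apply {F : E → E} (hF : ContDiff ℝ 1 F) (W : BddSeq E) (n : ℤ) :
    variationalCoeff hF W n = fderiv ℝ F (W n) :=
  rfl

theorem tendsto_variationalCoeff_sub {F : E → E} (hF : ContDiff ℝ 1 F) {W : BddSeq E}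
    (hW : Tendsto W cofinite (𝓝 0)) :
    Tendsto (fun n => variationalCoeff hF W n - variationalCoeff hF 0 n) cofinite (𝓝 0) :=
  tendsto_sub_nhds_zero_iff.2 <| ((hF.continuous_fderiv one_ne_zero).tendsto 0).comp hW

theorem exists_hasAPrioriBound_of_transverse {F : E → E} (hF : ContDiff ℝ 1 F)
    (hA : Function.Bijective (differenceOp (variationalCoeff hF 0))) {Q : ℤ → E}
    (hQ : IsHomoclinicOrbit F Q) (htrans : IntersectTransverselyAlong F Q) :
    ∃ K > 0, HasAPrioriBound (fun n => fderiv ℝ F (Q n)) K := by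
  have : CompleteSpace E := FiniteDimensional.complete ℝ E
  let Q' : BddSeq E := ⟨Q, memℓp_infty_of_tendsto_cofinite hQ.tendsto_cofinite⟩
  have hBA := tendsto_variationalCoeff_sub hF (W := Q') hQ.tendsto_cofinite
  obtain ⟨K₀, hK₀, hbound⟩ := exists_hasAPrioriBound hA
  have hsurj : Function.Surjective (differenceOp (variationalCoeff hF Q')) := by
    refine surjective_differenceOp_of_sup_eq_top hA hBA fun n => ?_
    rw [eq_top_iff, ← htrans n]
    refine sup_le_sup ?_ (unstableTangentSpace_le hF hK₀ hbound _)
    have hstable := stableTangentSpace_le hF hK₀ hbound (Q n)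
    simp only [hQ.1.iterate] at hstable
    exact hstable
  exact exists_hasAPrioriBound
    ⟨(injective_iff_surjective_differenceOp_of_tendsto hA hBA).2 hsurj, hsurj⟩

end Fredholm

section Shadowing

variable {E : Type*} [NormedAddCommGroup E]

/-- The nonlinear counterpart of `differenceOp`: its zeros are the bounded orbits of `F`. -/
noncomputable def orbitDefect [ProperSpace E] {F : E → E} (hF : Continuous F) (V : BddSeq E) :
    BddSeq E :=
  ⟨fun n => V (n + 1) - F (V n),
    let ⟨_, hC⟩ := exists_forall_norm_le_of_memℓp_infty (memℓp_infty_comp hF (lp.memℓp V))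
    memℓp_infty_of_forall_norm_le fun n =>
      norm_sub_le_of_le (lp.norm_apply_le_norm ENNReal.top_ne_zero V (n + 1)) (hC n)⟩

theorem orbitDefect_apply [ProperSpace E] {F : E → E} (hF : Continuous F) (V : BddSeq E) (n : ℤ) :
    orbitDefect hF V n = V (n + 1) - F (V n) :=
  rfl

variable [NormedSpace ℝ E] {F : E → E} {W : ℤ → E} {B : ℤ → E →L[ℝ] E} {K ρ : ℝ} {c : NNReal}

theorem approximatesLinearOn_orbitDefect [ProperSpace E] (hF : Continuous F) {W : BddSeq E}
    {B : BddSeq (E →L[ℝ] E)}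
    (happrox : ∀ n, ApproximatesLinearOn F (B n) (Metric.closedBall (W n) ρ) c) :
    ApproximatesLinearOn (orbitDefect hF) (differenceOp B) (Metric.closedBall W ρ) c := by
  have apply_mem {V : BddSeq E} (hV : V ∈ Metric.closedBall W ρ) (n) :
      V n ∈ Metric.closedBall (W n) ρ :=
    mem_closedBall_iff_norm.2 <| (lp.norm_apply_le_norm ENNReal.top_ne_zero (V - W) n).trans <|
      mem_closedBall_iff_norm.1 hV
  intro U hU V hV
  refine lp.norm_le_of_forall_le (by positivity) fun n => ?_
  have hn : (orbitDefect hF U - orbitDefect hF V - differenceOp B (U - V)) n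
      = -(F (U n) - F (V n) - B n (U n - V n)) := by
    simp only [lp.coeFn_sub, Pi.sub_apply, orbitDefect_apply, differenceOp_apply]
    abel
  rw [hn, norm_neg]
  refine (happrox n _ (apply_mem hU n) _ (apply_mem hV n)).trans ?_
  gcongr
  exact lp.norm_apply_le_norm ENNReal.top_ne_zero (U - V) n

theorem HasAPrioriBound.orbit_eq (hB : HasAPrioriBound B K)
    (happrox : ∀ n, ApproximatesLinearOn F (B n) (Metric.closedBall (W n) ρ) c)
    (hc : c * (2 * K) ≤ 1) {U V : ℤ → E} (hU : IsOrbit F U) (hV : IsOrbit F V)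
    (hUW : ∀ n, ‖U n - W n‖ ≤ ρ) (hVW : ∀ n, ‖V n - W n‖ ≤ ρ) : V = U := by
  funext n
  have hdiff := hB.norm_le_of_perturbation hc c.2 (V := fun n => V n - U n) (h := 0)
    (memℓp_infty_of_forall_norm_le (C := ρ + ρ) fun n => by
      rw [← sub_sub_sub_cancel_right _ _ (W n)]
      exact norm_sub_le_of_le (hVW n) (hUW n))
    (fun n => by
      rw [zero_add, hU n, hV n]
      exact happrox n _ (mem_closedBall_iff_norm.2 (hVW n)) _ (mem_closedBall_iff_norm.2 (hUW n))) n
  rw [mul_zero, mul_zero] at hdiff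
  exact sub_eq_zero.1 (norm_le_zero_iff.1 hdiff)

theorem exists_isOrbit_norm_sub_le [ProperSpace E] (hF : Continuous F)
    {W : BddSeq E} {B : BddSeq (E →L[ℝ] E)} (hsurj : Function.Surjective (differenceOp B))
    (hK : 0 < K) (hB : HasAPrioriBound (⇑B) K)
    (happrox : ∀ n, ApproximatesLinearOn F (B n) (Metric.closedBall (W n) ρ) c)
    (hc : c * (2 * K) ≤ 1) {e : ℝ} (heρ : 2 * (K * e) ≤ ρ)
    (hW : ∀ n, ‖W (n + 1) - F (W n)‖ ≤ e) :
    ∃ U, IsOrbit F U ∧ ∀ n, ‖U n - W n‖ ≤ 2 * (K * e) := by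
  have he : 0 ≤ e := (norm_nonneg _).trans (hW 0)
  let rightInv : (differenceOp B).NonlinearRightInverse :=
    { toFun := Function.surjInv hsurj
      nnnorm := K.toNNReal
      bound' := fun V => by
        rw [Real.coe_toNNReal K hK.le]
        refine lp.norm_le_of_forall_le (by positivity) (hB _ (lp.memℓp _) _ fun n => ?_)
        rw [← differenceOp_apply, Function.surjInv_eq hsurj]
        exact lp.norm_apply_le_norm ENNReal.top_ne_zero V n
      right_inv' := Function.surjInv_eq hsurj }
  have hrightInv : (rightInv.nnnorm : ℝ) = K := Real.coe_toNNReal K hK.le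
  obtain ⟨U, hUW, hU⟩ : (0 : BddSeq E) ∈ orbitDefect hF '' Metric.closedBall W (2 * (K * e)) := by
    refine (approximatesLinearOn_orbitDefect hF happrox).surjOn_closedBall_of_nonlinearRightInverse
      rightInv (by positivity) (Metric.closedBall_subset_closedBall heρ) ?_
    rw [hrightInv, mem_closedBall_iff_norm', sub_zero]
    calc ‖orbitDefect hF W‖ ≤ e := lp.norm_le_of_forall_le he hW
      _ ≤ e + e * (1 - c * (2 * K)) := le_add_of_nonneg_right (mul_nonneg he (sub_nonneg.2 hc))
      _ = (K⁻¹ - c) * (2 * (K * e)) := by field_simp; ring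
  refine ⟨U, fun n => sub_eq_zero.1 ?_, fun n => ?_⟩
  · rw [← orbitDefect_apply hF, hU, lp.coeFn_zero, Pi.zero_apply]
  · exact (lp.norm_apply_le_norm ENNReal.top_ne_zero (U - W) n).trans
      (mem_closedBall_iff_norm.1 hUW)

end Shadowing

section HomoclinicShadowing

variable {E : Type*} [NormedAddCommGroup E] [NormedSpace ℝ E] [FiniteDimensional ℝ E]
  {F : E → E} {r K₀ : ℝ} {g : ℤ → E →L[ℝ] E}

theorem exists_exponential_decay_of_isOrbit (hF : ContDiff ℝ 2 F) (hF0 : F 0 = 0)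
    (hg : IsGreenFunction (fderiv ℝ F 0) r K₀ g) (R : ℝ) :
    ∃ ε > 0, ∀ U, IsOrbit F U → (∀ n, ‖U n‖ ≤ R) → (∀ᶠ n in cofinite, ‖U n‖ ≤ ε) →
      ∃ D > 0, ∀ n, ‖U n‖ ≤ D * r ^ (-|n|) := by
  obtain ⟨Λ, -, hΛ⟩ := exists_lipschitzOnWith_fderiv hF R
  obtain ⟨ε, hε, hdecay⟩ := hg.exists_decay_of_sq_le Λ.2
  refine ⟨ε, hε, fun U hU hUR hUε => hdecay U (memℓp_infty_of_forall_norm_le hUR) (fun n => ?_) hUε⟩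
  rw [hU n]
  exact norm_map_sub_fderiv_zero_le (hF.differentiable two_ne_zero) hF0 hΛ (hUR n)

theorem exists_homoclinic_shadowing_radius (hF : ContDiff ℝ 2 F) (hF0 : F 0 = 0)
    (hg : IsGreenFunction (fderiv ℝ F 0) r K₀ g) {K : ℝ} (hK : 0 < K) (R : ℝ) :
    ∃ ρ > 0, ∀ W : ℤ → E, Tendsto W cofinite (𝓝 0) → (∀ n, ‖W n‖ ≤ R) →
      HasAPrioriBound (fun n => fderiv ℝ F (W n)) K →
      (∀ U V, IsOrbit F U → IsOrbit F V → (∀ n, ‖U n - W n‖ ≤ ρ) → (∀ n, ‖V n - W n‖ ≤ ρ) →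
        V = U) ∧
      ∀ e, 2 * (K * e) ≤ ρ → (∀ n, ‖W (n + 1) - F (W n)‖ ≤ e) →
        ∃ U, IsHomoclinicOrbit F U ∧ ∀ n, ‖U n - W n‖ ≤ 2 * (K * e) := by
  have : ProperSpace E := FiniteDimensional.proper ℝ E
  have hF₁ : ContDiff ℝ 1 F := hF.of_le one_le_two
  obtain ⟨Λ, hΛ₀, hΛ⟩ := exists_lipschitzOnWith_fderiv hF (R + 1)
  obtain ⟨ε, hε, hdecay⟩ := exists_exponential_decay_of_isOrbit hF hF0 hg (R + 1)
  obtain ⟨ρ, hρ, hρ_one, hρΛ, hρε⟩ : ∃ ρ > 0, ρ ≤ 1 ∧ Λ * ρ * (2 * K) ≤ 1 ∧ ρ ≤ ε / 2 := by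
    have : (0 : ℝ) < Λ := hΛ₀
    refine ⟨min 1 (min (1 / (Λ * (2 * K))) (ε / 2)), by positivity, min_le_left _ _, ?_,
      (min_le_right _ _).trans (min_le_right _ _)⟩
    rw [mul_right_comm, mul_comm, ← le_div_iff₀ (by positivity)]
    exact (min_le_right _ _).trans (min_le_left _ _)
  lift ρ to NNReal using hρ.le
  refine ⟨ρ, hρ, fun W hW₀ hWR hB => ?_⟩
  have happrox (n) : ApproximatesLinearOn F (fderiv ℝ F (W n)) (Metric.closedBall (W n) ρ)
      (Λ * ρ) :=
    approximatesLinearOn_closedBall (hF.differentiable two_ne_zero) hΛ (add_le_add (hWR n) hρ_one)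
  refine ⟨fun U V => hB.orbit_eq happrox hρΛ, fun e heρ hWe => ?_⟩
  let W' : BddSeq E := ⟨W, memℓp_infty_of_tendsto_cofinite hW₀⟩
  have hbij : Function.Bijective (differenceOp (variationalCoeff hF₁ W')) :=
    bijective_differenceOp_of_hasAPrioriBound
      (hg.bijective_differenceOp (variationalCoeff_apply hF₁ 0))
      (tendsto_variationalCoeff_sub hF₁ hW₀) hB
  obtain ⟨U, hU, hUW⟩ := exists_isOrbit_norm_sub_le (W := W') hF.continuous hbij.2 hK hB happrox
    hρΛ heρ hWe
  have norm_le_add (n) {a : ℝ} (ha : ‖W n‖ ≤ a) : ‖U n‖ ≤ a + ρ :=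
    (norm_le_norm_add_norm_sub' (U n) (W n)).trans (add_le_add ha ((hUW n).trans heρ))
  have hU_small : ∀ᶠ n in cofinite, ‖U n‖ ≤ ε := by
    filter_upwards [hW₀.norm.eventually_le_const (norm_zero.trans_lt (half_pos hε))] with n hn
    linarith [norm_le_add n hn]
  obtain ⟨D, -, hD⟩ := hdecay U hU (fun n => (norm_le_add n (hWR n)).trans (by gcongr)) hU_small
  exact ⟨U, hU.isHomoclinicOrbit (tendsto_cofinite_of_exponential_decay hg.one_lt hD), hUW⟩

end HomoclinicShadowing

section Superposition

theorem sum_pow_natAbs_sub_le {x : ℝ} (hx₀ : 0 ≤ x) (hx : x ≤ 1 / 2) {t : Finset ℕ} {i : ℕ}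
    (hi : i ∉ t) : ∑ j ∈ t, x ^ ((j : ℤ) - i).natAbs ≤ 4 * x := by
  have hsum : HasSum (fun z : ℤ => (1 / 2 : ℝ) ^ z.natAbs) (2 + 2 - (1 / 2) ^ (0 : ℤ).natAbs) :=
    .of_nat_of_neg (by simpa only [Int.natAbs_natCast] using hasSum_geometric_two)
      (by simpa only [Int.natAbs_neg, Int.natAbs_natCast] using hasSum_geometric_two)
  have hinj : Function.Injective fun j : ℕ => (j : ℤ) - i :=
    (sub_left_injective (b := (i : ℤ))).comp Nat.cast_injective
  have hle := sum_le_hasSum ((insert i t).map ⟨_, hinj⟩) (fun z _ => by positivity) hsum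
  simp only [Finset.sum_map, Function.Embedding.coeFn_mk, Finset.sum_insert hi, sub_self,
    Int.natAbs_zero, pow_zero] at hle
  have hterm (j) (hj : j ∈ t) :
      x ^ ((j : ℤ) - i).natAbs ≤ 2 * x * (1 / 2) ^ ((j : ℤ) - i).natAbs := by
    have hji : j ≠ i := ne_of_mem_of_not_mem hj hi
    obtain ⟨d, hd⟩ : ∃ d, ((j : ℤ) - i).natAbs = d + 1 :=
      Nat.exists_eq_succ_of_ne_zero (by omega)
    calc x ^ ((j : ℤ) - i).natAbs = x ^ d * x := by rw [hd, pow_succ]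
      _ ≤ (1 / 2) ^ d * x := by gcongr
      _ = 2 * x * (1 / 2) ^ ((j : ℤ) - i).natAbs := by rw [hd, pow_succ]; ring
  calc ∑ j ∈ t, x ^ ((j : ℤ) - i).natAbs
      ≤ 2 * x * ∑ j ∈ t, (1 / 2) ^ ((j : ℤ) - i).natAbs := by
        rw [Finset.mul_sum]
        exact Finset.sum_le_sum hterm
    _ ≤ 2 * x * 2 := by gcongr; linarith
    _ = 4 * x := by ring

theorem zpow_neg_le_pow_mul_rpow_neg_pow {r L : ℝ} (hr : 1 < r) {e : ℤ} {a d : ℕ}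
    (h : L * d ≤ e + a) : r ^ (-e) ≤ r ^ a * (r ^ (-L)) ^ d := by
  have hr₀ : 0 < r := one_pos.trans hr
  rw [← Real.rpow_intCast, ← Real.rpow_natCast, ← Real.rpow_natCast, ← Real.rpow_mul hr₀.le,
    ← Real.rpow_add hr₀]
  refine Real.rpow_le_rpow_of_exponent_le hr.le ?_
  push_cast
  linarith

variable {E : Type*} [NormedAddCommGroup E]

/-- The sum of the sequences `q i`, `i ∈ t`, each moved to its centre `c i`: the first
approximation of a multi-pulse. -/
def superposition (t : Finset ℕ) (c : ℕ → ℤ) (q : ℕ → ℤ → E) (n : ℤ) : E :=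
  ∑ j ∈ t, q j (n - c j)

/-- The sequences `q i` decay at the exponential rate `r` away from `0`, and the centres `c i`,
`i ∈ t`, to which they are going to be moved have consecutive distances at least `2 L`. The pulses
then overlap only up to powers of `r ^ (-L)`. -/
structure IsPulseTrain (t : Finset ℕ) (c : ℕ → ℤ) (q : ℕ → ℤ → E) (r D L : ℝ) : Prop where
  one_lt : 1 < r
  separated : ∀ i ∈ t, ∀ j ∈ t, 2 * L * ((j : ℤ) - i).natAbs ≤ (|c j - c i| : ℤ)
  norm_le : ∀ j n, ‖q j n‖ ≤ D * r ^ (-|n|)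

theorem exists_nearest_center {t : Finset ℕ} (ht : t.Nonempty) (c : ℕ → ℤ) (n : ℤ) :
    ∃ i ∈ t, ∀ j ∈ t, |c j - c i| ≤ 2 * |n - c j| ∧ |c j - c i| ≤ |n - c i| + |n - c j| := by
  obtain ⟨i, hi, hmin⟩ := Finset.exists_min_image t (fun j => |n - c j|) ht
  refine ⟨i, hi, fun j hj => ?_⟩
  have htri : |c j - c i| ≤ |n - c i| + |n - c j| := by
    simpa only [sub_sub_sub_cancel_left] using abs_sub (n - c i) (n - c j)
  exact ⟨htri.trans (by linarith [hmin j hj]), htri⟩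

section Overlap

variable {t : Finset ℕ} {c : ℕ → ℤ} {q : ℕ → ℤ → E} {r D L : ℝ}

theorem IsPulseTrain.nonneg (h : IsPulseTrain t c q r D L) : 0 ≤ D := by
  simpa using (norm_nonneg _).trans (h.norm_le 0 0)

theorem IsPulseTrain.rate_pos (h : IsPulseTrain t c q r D L) : 0 < r := one_pos.trans h.one_lt

theorem IsPulseTrain.norm_le_const (h : IsPulseTrain t c q r D L) (j : ℕ) (n : ℤ) :
    ‖q j n‖ ≤ D :=
  (h.norm_le j n).trans <| mul_le_of_le_one_right h.nonneg <|
    zpow_le_one_of_nonpos₀ h.one_lt.le (neg_nonpos.2 (abs_nonneg n))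

theorem IsPulseTrain.norm_le_of_abs_sub_le (h : IsPulseTrain t c q r D L) {i j a : ℕ} {n : ℤ}
    (hi : i ∈ t) (hj : j ∈ t) (hd : |c j - c i| ≤ 2 * (|n - c j| + a)) :
    ‖q j (n - c j)‖ ≤ D * r ^ a * (r ^ (-L)) ^ ((j : ℤ) - i).natAbs := by
  have hsep := (h.separated i hi j hj).trans (Int.cast_le.2 hd)
  push_cast at hsep
  rw [mul_assoc D]
  refine (h.norm_le j _).trans (mul_le_mul_of_nonneg_left ?_ h.nonneg)
  exact zpow_neg_le_pow_mul_rpow_neg_pow h.one_lt (by push_cast; linarith)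

theorem IsPulseTrain.norm_le_sq_of_abs_sub_le (h : IsPulseTrain t c q r D L) {i j : ℕ} {n : ℤ}
    (hi : i ∈ t) (hj : j ∈ t) (hd : |c j - c i| ≤ |n - c j|) :
    ‖q j (n - c j)‖ ≤ D * ((r ^ (-L)) ^ 2) ^ ((j : ℤ) - i).natAbs := by
  have hsep := (h.separated i hi j hj).trans (Int.cast_le.2 hd)
  refine (h.norm_le j _).trans (mul_le_mul_of_nonneg_left ?_ h.nonneg)
  simpa only [pow_zero, one_mul, pow_mul] using zpow_neg_le_pow_mul_rpow_neg_pow (L := L) (a := 0)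
    (d := 2 * ((j : ℤ) - i).natAbs) (e := |n - c j|) h.one_lt (by push_cast at hsep ⊢; linarith)

theorem IsPulseTrain.norm_mul_norm_le (h : IsPulseTrain t c q r D L) {i j : ℕ} {n : ℤ}
    (hi : i ∈ t) (hj : j ∈ t) (hd : |c j - c i| ≤ |n - c i| + |n - c j|) :
    ‖q i (n - c i)‖ * ‖q j (n - c j)‖ ≤ D ^ 2 * ((r ^ (-L)) ^ 2) ^ ((j : ℤ) - i).natAbs := by
  have hsep := (h.separated i hi j hj).trans (Int.cast_le.2 hd)
  have hr := h.rate_pos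
  have hD := h.nonneg
  have hpow := zpow_neg_le_pow_mul_rpow_neg_pow (L := L) (a := 0)
    (d := 2 * ((j : ℤ) - i).natAbs) (e := |n - c i| + |n - c j|) h.one_lt
    (by push_cast at hsep ⊢; linarith)
  rw [pow_zero, one_mul, pow_mul, neg_add, zpow_add₀ hr.ne'] at hpow
  calc ‖q i (n - c i)‖ * ‖q j (n - c j)‖
      ≤ D * r ^ (-|n - c i|) * (D * r ^ (-|n - c j|)) := by
        gcongr <;> exact h.norm_le _ _
    _ = D ^ 2 * (r ^ (-|n - c i|) * r ^ (-|n - c j|)) := by ring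
    _ ≤ D ^ 2 * ((r ^ (-L)) ^ 2) ^ ((j : ℤ) - i).natAbs := by gcongr

theorem IsPulseTrain.sum_erase_norm_le (h : IsPulseTrain t c q r D L) (hL : r ^ (-L) ≤ 1 / 2)
    {i a : ℕ} (hi : i ∈ t) {n : ℤ} (hd : ∀ j ∈ t, |c j - c i| ≤ 2 * (|n - c j| + a)) :
    ∑ j ∈ t.erase i, ‖q j (n - c j)‖ ≤ 4 * D * r ^ a * r ^ (-L) := by
  have hr := h.rate_pos
  have hD := h.nonneg
  calc ∑ j ∈ t.erase i, ‖q j (n - c j)‖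
      ≤ ∑ j ∈ t.erase i, D * r ^ a * (r ^ (-L)) ^ ((j : ℤ) - i).natAbs :=
        Finset.sum_le_sum fun j hj =>
          have hjt := Finset.mem_of_mem_erase hj
          h.norm_le_of_abs_sub_le hi hjt (hd j hjt)
    _ = D * r ^ a * ∑ j ∈ t.erase i, (r ^ (-L)) ^ ((j : ℤ) - i).natAbs := by rw [Finset.mul_sum]
    _ ≤ D * r ^ a * (4 * r ^ (-L)) := by
        gcongr
        exact sum_pow_natAbs_sub_le (by positivity) hL (Finset.notMem_erase i t)
    _ = 4 * D * r ^ a * r ^ (-L) := by ring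

theorem IsPulseTrain.norm_superposition_sub_le (h : IsPulseTrain t c q r D L)
    (hL : r ^ (-L) ≤ 1 / 2) {i a : ℕ} (hi : i ∈ t) {n : ℤ}
    (hd : ∀ j ∈ t, |c j - c i| ≤ 2 * (|n - c j| + a)) :
    ‖superposition t c q n - q i (n - c i)‖ ≤ 4 * D * r ^ a * r ^ (-L) := by
  rw [superposition, ← Finset.sum_erase_eq_sub hi]
  exact (norm_sum_le _ _).trans (h.sum_erase_norm_le hL hi hd)

theorem IsPulseTrain.norm_superposition_le (h : IsPulseTrain t c q r D L)
    (hL : r ^ (-L) ≤ 1 / 2) (ht : t.Nonempty) (n : ℤ) : ‖superposition t c q n‖ ≤ 3 * D := by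
  obtain ⟨i, hi, hnear⟩ := exists_nearest_center ht c n
  have hsub := h.norm_superposition_sub_le (a := 0) hL hi
    fun j hj => by simpa only [Nat.cast_zero, add_zero] using (hnear j hj).1
  have hD := h.nonneg
  have hsmall : 4 * D * r ^ 0 * r ^ (-L) ≤ 4 * D * r ^ 0 * (1 / 2) := by gcongr
  rw [pow_zero] at hsub hsmall
  linarith [norm_le_insert' (superposition t c q n) (q i (n - c i)), h.norm_le_const i (n - c i)]

theorem IsPulseTrain.tendsto_superposition (h : IsPulseTrain t c q r D L) :
    Tendsto (superposition t c q) cofinite (𝓝 0) := by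
  rw [← Finset.sum_const_zero (s := t)]
  exact tendsto_finsetSum _ fun j _ =>
    (tendsto_cofinite_of_exponential_decay h.one_lt (h.norm_le j)).comp
      (sub_left_injective (b := c j)).tendsto_cofinite

theorem IsPulseTrain.norm_superposition_sub_sub_le (h : IsPulseTrain t c q r D L)
    (hL : r ^ (-L) ≤ 1 / 2) {i i' : ℕ} (hi : i ∈ t) (hi' : i' ∈ t) (hne : i' ≠ i) {n : ℤ}
    (hd : ∀ j ∈ t, j ≠ i → j ≠ i' → |c j - c i| ≤ |n - c j| ∨ |c j - c i'| ≤ |n - c j|) :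
    ‖superposition t c q n - q i (n - c i) - q i' (n - c i')‖ ≤ 8 * D * (r ^ (-L)) ^ 2 := by
  have hr := h.rate_pos
  have hD := h.nonneg
  rw [superposition, ← Finset.sum_erase_eq_sub hi,
    ← Finset.sum_erase_eq_sub (Finset.mem_erase.2 ⟨hne, hi'⟩)]
  set x := (r ^ (-L)) ^ 2
  have hx₀ : 0 ≤ x := by positivity
  have hx_le : x ≤ 1 / 2 :=
    (pow_le_of_le_one (by positivity) (by linarith) two_ne_zero).trans hL
  have hterm (j) (hj : j ∈ (t.erase i).erase i') : ‖q j (n - c j)‖ ≤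
      D * x ^ ((j : ℤ) - i).natAbs + D * x ^ ((j : ℤ) - i').natAbs := by
    simp only [Finset.mem_erase] at hj
    rcases hd j hj.2.2 hj.2.1 hj.1 with hji | hji
    · exact (h.norm_le_sq_of_abs_sub_le hi hj.2.2 hji).trans
        (le_add_of_nonneg_right (by positivity))
    · exact (h.norm_le_sq_of_abs_sub_le hi' hj.2.2 hji).trans
        (le_add_of_nonneg_left (by positivity))
  calc ‖∑ j ∈ (t.erase i).erase i', q j (n - c j)‖
      ≤ ∑ j ∈ (t.erase i).erase i', (D * x ^ ((j : ℤ) - i).natAbs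
          + D * x ^ ((j : ℤ) - i').natAbs) :=
        (norm_sum_le _ _).trans (Finset.sum_le_sum hterm)
    _ = D * ∑ j ∈ (t.erase i).erase i', x ^ ((j : ℤ) - i).natAbs
          + D * ∑ j ∈ (t.erase i).erase i', x ^ ((j : ℤ) - i').natAbs := by
        rw [Finset.sum_add_distrib, Finset.mul_sum, Finset.mul_sum]
    _ ≤ D * (4 * x) + D * (4 * x) := by
        gcongr
        · refine sum_pow_natAbs_sub_le hx₀ hx_le fun hmem => ?_
          exact Finset.notMem_erase i t (Finset.mem_of_mem_erase hmem)
        · exact sum_pow_natAbs_sub_le hx₀ hx_le (Finset.notMem_erase i' _)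
    _ = 8 * D * x := by ring

end Overlap

variable [NormedSpace ℝ E] {F : E → E}

theorem norm_sum_map_sub_map_sum_le {ι : Type*} [DecidableEq ι] (hF : Differentiable ℝ F)
    (hF0 : F 0 = 0) {Λ : NNReal} {R Y : ℝ}
    (hΛ : LipschitzOnWith Λ (fderiv ℝ F) (Metric.closedBall 0 R)) {t : Finset ι} {i : ι}
    (hi : i ∈ t) (p : ι → E) (hY : ∑ j ∈ t.erase i, ‖p j‖ ≤ Y) (hR : ‖p i‖ + Y ≤ R) :
    ‖∑ j ∈ t, F (p j) - F (∑ j ∈ t, p j)‖ ≤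
      Λ * (∑ j ∈ t.erase i, ‖p i‖ * ‖p j‖ + 2 * Y ^ 2) := by
  set y := ∑ j ∈ t.erase i, p j with hy
  have hyY : ‖y‖ ≤ Y := (norm_sum_le _ _).trans hY
  have hpi := norm_nonneg (p i)
  have hY₀ : 0 ≤ Y := (norm_nonneg y).trans hyY
  have hpY (j) (hj : j ∈ t.erase i) : ‖p j‖ ≤ Y :=
    (Finset.single_le_sum (f := fun j => ‖p j‖) (fun _ _ => norm_nonneg _) hj).trans hY
  have hlin {z : E} (hz : ‖z‖ ≤ Y) : ‖F z - fderiv ℝ F 0 z‖ ≤ Λ * ‖z‖ ^ 2 :=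
    norm_map_sub_fderiv_zero_le hF hF0 hΛ (by linarith)
  have htail : ‖∑ j ∈ t.erase i, (F (p j) - fderiv ℝ F 0 (p j))‖ ≤ Λ * Y ^ 2 := by
    calc _ ≤ ∑ j ∈ t.erase i, Λ * Y * ‖p j‖ := by
          refine (norm_sum_le _ _).trans (Finset.sum_le_sum fun j hj => (hlin (hpY j hj)).trans ?_)
          rw [pow_two, mul_assoc]
          gcongr
          exact hpY j hj
      _ ≤ Λ * Y * Y := by rw [← Finset.mul_sum]; gcongr
      _ = Λ * Y ^ 2 := by ring
  have hy_lin : ‖F y - fderiv ℝ F 0 y‖ ≤ Λ * Y ^ 2 := (hlin hyY).trans (by gcongr)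
  have hcross : ‖F (p i + y) - F (p i) - F y‖ ≤ Λ * ∑ j ∈ t.erase i, ‖p i‖ * ‖p j‖ := by
    refine (norm_map_add_sub_sub_le hF hF0 hΛ (by linarith)).trans ?_
    rw [mul_assoc, ← Finset.mul_sum]
    gcongr
    exact norm_sum_le _ _
  have hsplit : ∑ j ∈ t, F (p j) - F (∑ j ∈ t, p j) =
      ∑ j ∈ t.erase i, (F (p j) - fderiv ℝ F 0 (p j)) - (F y - fderiv ℝ F 0 y)
        - (F (p i + y) - F (p i) - F y) := by
    rw [← Finset.add_sum_erase t p hi, ← Finset.add_sum_erase t (fun j => F (p j)) hi,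
      Finset.sum_sub_distrib, ← map_sum, ← hy]
    abel
  rw [hsplit]
  linarith [norm_sub_le (∑ j ∈ t.erase i, (F (p j) - fderiv ℝ F 0 (p j)) -
    (F y - fderiv ℝ F 0 y)) (F (p i + y) - F (p i) - F y), norm_sub_le
    (∑ j ∈ t.erase i, (F (p j) - fderiv ℝ F 0 (p j))) (F y - fderiv ℝ F 0 y)]

variable {t : Finset ℕ} {c : ℕ → ℤ} {q : ℕ → ℤ → E} {r D L : ℝ} {Λ : NNReal}

theorem IsPulseTrain.norm_superposition_succ_sub_map_le (h : IsPulseTrain t c q r D L)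
    (hL : r ^ (-L) ≤ 1 / 2) (ht : t.Nonempty) (hF : Differentiable ℝ F) (hF0 : F 0 = 0)
    (hΛ : LipschitzOnWith Λ (fderiv ℝ F) (Metric.closedBall 0 (3 * D)))
    (hq : ∀ j, IsOrbit F (q j)) (n : ℤ) :
    ‖superposition t c q (n + 1) - F (superposition t c q n)‖ ≤
      36 * Λ * D ^ 2 * (r ^ (-L)) ^ 2 := by
  obtain ⟨i, hi, hnear⟩ := exists_nearest_center ht c n
  have hr := h.rate_pos
  have hD := h.nonneg
  have hpi := h.norm_le_const i (n - c i)
  have hx_le : (r ^ (-L)) ^ 2 ≤ 1 / 2 :=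
    (pow_le_of_le_one (by positivity) (by linarith) two_ne_zero).trans hL
  have hY : ∑ j ∈ t.erase i, ‖q j (n - c j)‖ ≤ 4 * D * r ^ (-L) := by
    simpa only [pow_zero, mul_one] using h.sum_erase_norm_le (a := 0) hL hi
      fun j hj => by simpa only [Nat.cast_zero, add_zero] using (hnear j hj).1
  have hcross : ∑ j ∈ t.erase i, ‖q i (n - c i)‖ * ‖q j (n - c j)‖ ≤
      4 * D ^ 2 * (r ^ (-L)) ^ 2 := by
    calc _ ≤ ∑ j ∈ t.erase i, D ^ 2 * ((r ^ (-L)) ^ 2) ^ ((j : ℤ) - i).natAbs :=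
          Finset.sum_le_sum fun j hj =>
            have hjt := Finset.mem_of_mem_erase hj
            h.norm_mul_norm_le hi hjt (hnear j hjt).2
      _ ≤ D ^ 2 * (4 * (r ^ (-L)) ^ 2) := by
          rw [← Finset.mul_sum]
          gcongr
          exact sum_pow_natAbs_sub_le (by positivity) hx_le (Finset.notMem_erase i t)
      _ = 4 * D ^ 2 * (r ^ (-L)) ^ 2 := by ring
  have hYD : 4 * D * r ^ (-L) ≤ 4 * D * (1 / 2) := by gcongr
  have hstep : superposition t c q (n + 1) = ∑ j ∈ t, F (q j (n - c j)) :=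
    Finset.sum_congr rfl fun j _ => by rw [← hq, sub_add_eq_add_sub]
  rw [hstep]
  calc _ ≤ Λ * (∑ j ∈ t.erase i, ‖q i (n - c i)‖ * ‖q j (n - c j)‖
          + 2 * (4 * D * r ^ (-L)) ^ 2) :=
        norm_sum_map_sub_map_sum_le hF hF0 hΛ hi (fun j => q j (n - c j)) hY (by linarith)
    _ ≤ Λ * (4 * D ^ 2 * (r ^ (-L)) ^ 2 + 2 * (4 * D * r ^ (-L)) ^ 2) := by gcongr
    _ = 36 * Λ * D ^ 2 * (r ^ (-L)) ^ 2 := by ring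

theorem IsPulseTrain.hasAPrioriBound_superposition (h : IsPulseTrain t c q r D L)
    (hL : r ^ (-L) ≤ 1 / 2) (ht : t.Nonempty)
    (hΛ : LipschitzOnWith Λ (fderiv ℝ F) (Metric.closedBall 0 (3 * D))) {K : ℝ}
    (hK : ∀ j, HasAPrioriBound (fun n => fderiv ℝ F (q j n)) K) {l : ℕ} (hl : 0 < l)
    (hsmall : K * ((‖fderiv ℝ F 0‖ + Λ * (3 * D)) / l + Λ * (4 * D * r ^ l * r ^ (-L))) ≤ 1 / 2) :
    HasAPrioriBound (fun n => fderiv ℝ F (superposition t c q n)) (2 * K) := by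
  have hr := h.rate_pos
  have hD := h.nonneg
  have hmem (n) : superposition t c q n ∈ Metric.closedBall 0 (3 * D) :=
    mem_closedBall_zero_iff.2 (h.norm_superposition_le hL ht n)
  refine hasAPrioriBound_of_windows hl (by positivity) (fun n => ?_) hsmall fun n₀ => ?_
  · refine (norm_le_norm_add_norm_sub' _ (fderiv ℝ F 0)).trans (add_le_add_right ?_ _)
    refine (hΛ.norm_sub_le (hmem n) (Metric.mem_closedBall_self (by positivity))).trans ?_
    rw [sub_zero]
    gcongr
    exact h.norm_superposition_le hL ht n
  · obtain ⟨i, hi, hnear⟩ := exists_nearest_center ht c n₀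
    refine ⟨fun n => fderiv ℝ F (q i (n - c i)), (hK i).shift (c i), fun n hn => ?_⟩
    have hpulse : q i (n - c i) ∈ Metric.closedBall 0 (3 * D) :=
      mem_closedBall_zero_iff.2 ((h.norm_le_const i _).trans (by linarith))
    refine (hΛ.norm_sub_le (hmem n) hpulse).trans (mul_le_mul_of_nonneg_left ?_ Λ.2)
    refine h.norm_superposition_sub_le hL hi fun j hj => (hnear j hj).1.trans ?_
    have htri : |n₀ - c j| ≤ |n - c j| + |n - n₀| := by
      simpa only [sub_sub_sub_cancel_left] using abs_sub (n - c j) (n - n₀)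
    linarith

end Superposition

section SuperpositionShadowing

variable {E : Type*} [NormedAddCommGroup E] [NormedSpace ℝ E] [FiniteDimensional ℝ E]
  {F : E → E} {r K₀ : ℝ} {g : ℤ → E →L[ℝ] E}

theorem IsHomoclinicOrbit.exists_exponential_decay {Q : ℤ → E} (hQ : IsHomoclinicOrbit F Q)
    (hF : ContDiff ℝ 2 F) (hF0 : F 0 = 0) (hg : IsGreenFunction (fderiv ℝ F 0) r K₀ g) :
    ∃ D > 0, ∀ n, ‖Q n‖ ≤ D * r ^ (-|n|) := by
  obtain ⟨R, hR⟩ :=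
    exists_forall_norm_le_of_memℓp_infty (memℓp_infty_of_tendsto_cofinite hQ.tendsto_cofinite)
  obtain ⟨ε, hε, hdecay⟩ := exists_exponential_decay_of_isOrbit hF hF0 hg R
  exact hdecay Q hQ.1 hR <|
    hQ.tendsto_cofinite.norm.eventually_le_const (norm_zero.trans_lt hε)

theorem tendsto_rpow_neg_atTop_of_one_lt (hr : 1 < r) :
    Tendsto (fun L : ℝ => r ^ (-L)) atTop (𝓝 0) :=
  (tendsto_rpow_atBot_of_base_gt_one r hr).comp tendsto_neg_atTop_atBot

theorem exists_window_length (hr : 1 < r) (K b a : ℝ) :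
    ∃ l : ℕ, 0 < l ∧ ∀ᶠ L : ℝ in atTop, K * (b / l + a * r ^ l * r ^ (-L)) ≤ 1 / 2 := by
  have hl : Tendsto (fun l : ℕ => K * (b / l)) atTop (𝓝 (K * 0)) :=
    (tendsto_const_div_atTop_nhds_zero_nat b).const_mul K
  obtain ⟨l, hlt, hl₀⟩ := ((hl.eventually_lt_const (by rw [mul_zero]; exact one_half_pos)).and
    (eventually_gt_atTop 0)).exists
  have hL : Tendsto (fun L : ℝ => K * (b / l + a * r ^ l * r ^ (-L))) atTop
      (𝓝 (K * (b / l + a * r ^ l * 0))) :=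
    (((tendsto_rpow_neg_atTop_of_one_lt hr).const_mul _).const_add _).const_mul K
  exact ⟨l, hl₀, hL.eventually_le_const (by rwa [mul_zero, add_zero])⟩

theorem exists_superposition_shadowing (hF : ContDiff ℝ 2 F) (hF0 : F 0 = 0)
    (hg : IsGreenFunction (fderiv ℝ F 0) r K₀ g) {K : ℝ} (hK : 0 < K) (D : ℝ) :
    ∃ ρ > 0, ∃ C ≥ 0, ∀ᶠ L : ℝ in atTop, 
      ∀ (t : Finset ℕ) (c : ℕ → ℤ) (q : ℕ → ℤ → E), t.Nonempty →
      IsPulseTrain t c q r D L → (∀ j, IsOrbit F (q j)) →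
      (∀ j, HasAPrioriBound (fun n => fderiv ℝ F (q j n)) K) →
      (∀ U V, IsOrbit F U → IsOrbit F V → (∀ n, ‖U n - superposition t c q n‖ ≤ ρ) →
        (∀ n, ‖V n - superposition t c q n‖ ≤ ρ) → V = U) ∧
      ∃ U, IsHomoclinicOrbit F U ∧
        ∀ n, ‖U n - superposition t c q n‖ ≤ C * (r ^ (-L)) ^ 2 := by
  obtain ⟨ρ, hρ, hshadow⟩ :=
    exists_homoclinic_shadowing_radius hF hF0 hg (mul_pos two_pos hK) (3 * D)
  obtain ⟨Λ, -, hΛ⟩ := exists_lipschitzOnWith_fderiv hF (3 * D)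
  obtain ⟨l, hl, hwindow⟩ :=
    exists_window_length hg.one_lt K (‖fderiv ℝ F 0‖ + Λ * (3 * D)) (Λ * (4 * D))
  have htend := tendsto_rpow_neg_atTop_of_one_lt hg.one_lt
  have herror : ∀ᶠ L : ℝ in atTop, 2 * (2 * K * (36 * Λ * D ^ 2)) * (r ^ (-L)) ^ 2 ≤ ρ :=
    ((htend.pow 2).const_mul _).eventually_le_const
      (by rwa [zero_pow two_ne_zero, mul_zero])
  refine ⟨ρ, hρ, 2 * (2 * K * (36 * Λ * D ^ 2)), by positivity, ?_⟩
  filter_upwards [htend.eventually_le_const one_half_pos, hwindow, herror]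
    with L hL hsmall hLρ t c q ht h hq hB
  obtain ⟨hunique, hexists⟩ := hshadow (superposition t c q) h.tendsto_superposition
    (h.norm_superposition_le hL ht)
    (h.hasAPrioriBound_superposition hL ht hΛ hB hl (by simpa only [mul_assoc] using hsmall))
  refine ⟨hunique, ?_⟩
  have hdefect :=
    h.norm_superposition_succ_sub_map_le hL ht (hF.differentiable two_ne_zero) hF0 hΛ hq
  simpa only [mul_assoc] using hexists _ (by simpa only [mul_assoc] using hLρ) hdefect

end SuperpositionShadowing

section Centers

variable {m : ℕ} {N : ℕ → ℕ}

theorem center_mono (N : ℕ → ℕ) : Monotone (center N) := fun _ _ hij =>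
  Finset.sum_le_sum_of_subset_of_nonneg (Finset.Ico_subset_Ico_right hij)
    fun _ _ _ => Nat.cast_nonneg _

theorem center_succ (N : ℕ → ℕ) {i : ℕ} (hi : 1 ≤ i) : center N (i + 1) = center N i + N i :=
  Finset.sum_Ico_succ_top hi _

theorem two_mul_halfMinDist_mul_sub_le (m : ℕ) (N : ℕ → ℕ) {i j : ℕ} (hi : 1 ≤ i) (hij : i ≤ j)
    (hj : j ≤ m) : 2 * halfMinDist m N * ((j : ℝ) - i) ≤ (center N j - center N i : ℤ) := by
  induction j, hij using Nat.le_induction with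
  | base => simp only [sub_self, mul_zero, Int.cast_zero, le_refl]
  | succ j hij ih =>
    have hmin : 2 * halfMinDist m N ≤ N j := by
      rw [halfMinDist, mul_div_cancel₀ _ two_ne_zero]
      exact Nat.cast_le.2 (Nat.sInf_le ⟨j, ⟨hi.trans hij, by omega⟩, rfl⟩)
    have := ih (by omega)
    rw [center_succ N (hi.trans hij)]
    push_cast at this ⊢
    linarith

theorem two_mul_halfMinDist_mul_natAbs_le (m : ℕ) (N : ℕ → ℕ) {i j : ℕ}
    (hi : i ∈ Finset.Icc 1 m) (hj : j ∈ Finset.Icc 1 m) :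
    2 * halfMinDist m N * ((j : ℤ) - i).natAbs ≤ (|center N j - center N i| : ℤ) := by
  rw [Finset.mem_Icc] at hi hj
  wlog hij : i ≤ j generalizing i j
  · rw [← Int.natAbs_neg, neg_sub, abs_sub_comm]
    exact this hj hi (le_of_not_ge hij)
  rw [abs_of_nonneg (sub_nonneg.2 (center_mono N hij)), Nat.cast_natAbs,
    abs_of_nonneg (by omega)]
  exact_mod_cast two_mul_halfMinDist_mul_sub_le m N hi.1 hij hj.2

theorem abs_center_sub_le_of_mem_domain {i j : ℕ} (hi : i ∈ Finset.Icc 1 m)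
    (hj : j ∈ Finset.Icc 1 m) {n : ℤ} (hn : n ∈ leftDomain N i ∪ rightDomain m N i) :
    |center N j - center N i| ≤ 2 * (|center N i + n - center N j| + 1) := by
  rw [Finset.mem_Icc] at hi hj
  rcases lt_trichotomy i j with hij | rfl | hij
  · have hmono := center_mono N hij
    have hsucc := center_succ N hi.1
    rcases hn with ⟨hn₀, -⟩ | ⟨-, hn⟩
    · grind
    · have := hn (by omega)
      grind [distPlus]
  · rw [sub_self, abs_zero]
    positivity
  · have hmono := center_mono N (show j ≤ i - 1 by omega)
    have hsucc := center_succ N (i := i - 1) (by omega)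
    rw [Nat.sub_add_cancel hi.1] at hsucc
    rcases hn with ⟨-, hn⟩ | ⟨hn₀, -⟩
    · have := hn (by omega)
      grind [distPlus, distMinus]
    · grind

theorem abs_center_sub_le_of_ne {i j : ℕ} (hi : 1 ≤ i) (hji : j ≠ i) :
    |center N j - center N i| ≤ |center N i + distPlus N i - center N j| ∨
      |center N j - center N (i + 1)| ≤ |center N i + distPlus N i - center N j| := by
  have hsucc := center_succ N hi
  rcases lt_or_gt_of_ne hji with hlt | hlt
  · have hmono := center_mono N hlt.le
    grind [distPlus]
  · have hmono := center_mono N (show i + 1 ≤ j by omega)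
    grind [distPlus]

theorem exists_mem_domain (hm : 1 ≤ m) (N : ℕ → ℕ) (n : ℤ) :
    ∃ i, 1 ≤ i ∧ i ≤ m ∧ n - center N i ∈ leftDomain N i ∪ rightDomain m N i := by
  let s := (Finset.Icc 1 m).filter fun i => i ≠ 1 → center N i - distMinus N (i - 1) ≤ n
  have hs : s.Nonempty :=
    ⟨1, Finset.mem_filter.2 ⟨Finset.mem_Icc.2 ⟨le_rfl, hm⟩, fun h => absurd rfl h⟩⟩
  obtain ⟨hi, hleft⟩ := Finset.mem_filter.1 (s.max'_mem hs)
  set i := s.max' hs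
  rw [Finset.mem_Icc] at hi
  refine ⟨i, hi.1, hi.2, ?_⟩
  rcases le_or_gt n (center N i) with hn | hn
  · exact Or.inl ⟨by omega, fun hi₁ => by linarith [hleft hi₁]⟩
  · refine Or.inr ⟨by omega, fun him => ?_⟩
    by_contra hright
    have hmem : i + 1 ∈ s := by
      refine Finset.mem_filter.2 ⟨Finset.mem_Icc.2 ⟨by omega, by omega⟩, fun _ => ?_⟩
      rw [center_succ N hi.1, Nat.add_sub_cancel, distMinus]
      omega
    exact (s.le_max' _ hmem).not_gt i.lt_succ_self

theorem exists_forall_halfMinDist_of_eventually {P : ℝ → Prop} (hP : ∀ᶠ L in atTop, P L) :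
    ∃ N₀ > 0, ∀ (m : ℕ) (N : ℕ → ℕ), 1 < m → (∀ i, 1 ≤ i → i ≤ m - 1 → N₀ ≤ N i) →
      P (halfMinDist m N) := by
  obtain ⟨L₀, hL₀⟩ := eventually_atTop.1 hP
  obtain ⟨N₀, hN₀⟩ := exists_nat_ge (2 * L₀)
  refine ⟨N₀ + 1, N₀.succ_pos, fun m N hm hN => hL₀ _ ?_⟩
  obtain ⟨i, hi, hi_min⟩ := Nat.sInf_mem (s := N '' Set.Icc 1 (m - 1))
    ⟨N 1, 1, ⟨le_rfl, by omega⟩, rfl⟩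
  rw [halfMinDist, le_div_iff₀ two_pos, mul_comm, ← hi_min]
  exact hN₀.trans (Nat.cast_le.2 (N₀.le_succ.trans (hN i hi.1 hi.2)))

end Centers

section Pulses

theorem fderiv_map_of_commute {E : Type*} [NormedAddCommGroup E] [NormedSpace ℝ E] {F : E → E}
    (hF : Differentiable ℝ F) (T : E ≃ₗᵢ[ℝ] E) (hT : ∀ x, F (T x) = T (F x)) (x v : E) :
    fderiv ℝ F (T x) (T v) = T (fderiv ℝ F x v) := by
  let L : E →L[ℝ] E := T.toContinuousLinearEquiv
  have hFL : HasFDerivAt (F ∘ L) ((fderiv ℝ F (T x)).comp L) x :=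
    HasFDerivAt.comp x (hF (T x)).hasFDerivAt L.hasFDerivAt
  have hLF : HasFDerivAt (L ∘ F) (L.comp (fderiv ℝ F x)) x :=
    HasFDerivAt.comp x L.hasFDerivAt (hF x).hasFDerivAt
  have hcomm : F ∘ L = L ∘ F := funext hT
  rw [hcomm] at hFL
  exact DFunLike.congr_fun (hFL.unique hLF) v

variable {k : ℕ} {G : Type*} [Group G]
  {F : EuclideanSpace ℝ (Fin k) → EuclideanSpace ℝ (Fin k)}
  {T : G →* (EuclideanSpace ℝ (Fin k) ≃ₗᵢ[ℝ] EuclideanSpace ℝ (Fin k))}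
  {Q U V : ℤ → EuclideanSpace ℝ (Fin k)} {m : ℕ} {N : ℕ → ℕ} {θ : ℕ → G} {r D δ e : ℝ}

/-- The pulse shapes `T(θ_i) Q` of a multi-pulse, indexed by `i` and centred at `0`. -/
noncomputable def rotatedOrbit
    (T : G →* (EuclideanSpace ℝ (Fin k) ≃ₗᵢ[ℝ] EuclideanSpace ℝ (Fin k)))
    (Q : ℤ → EuclideanSpace ℝ (Fin k)) (θ : ℕ → G) (i : ℕ) (n : ℤ) : EuclideanSpace ℝ (Fin k) :=
  T (θ i) (Q n)

/-- The leading-order approximation of the multi-pulse: the sum of the pulses `T(θ_i) Q`,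
`1 ≤ i ≤ m`, shifted to their centres. -/
noncomputable def pulseSum
    (T : G →* (EuclideanSpace ℝ (Fin k) ≃ₗᵢ[ℝ] EuclideanSpace ℝ (Fin k)))
    (Q : ℤ → EuclideanSpace ℝ (Fin k)) (m : ℕ) (N : ℕ → ℕ) (θ : ℕ → G) :
    ℤ → EuclideanSpace ℝ (Fin k) :=
  superposition (Finset.Icc 1 m) (center N) (rotatedOrbit T Q θ)

theorem isOrbit_rotatedOrbit (hT : ∀ (g : G) U, F (T g U) = T g (F U)) (hQ : IsOrbit F Q)
    (θ : ℕ → G) (i : ℕ) : IsOrbit F (rotatedOrbit T Q θ i) := fun n => by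
  rw [rotatedOrbit, rotatedOrbit, hQ n, hT]

theorem hasAPrioriBound_rotatedOrbit (hF : Differentiable ℝ F)
    (hT : ∀ (g : G) U, F (T g U) = T g (F U)) {K : ℝ}
    (hB : HasAPrioriBound (fun n => fderiv ℝ F (Q n)) K) (θ : ℕ → G) (i : ℕ) :
    HasAPrioriBound (fun n => fderiv ℝ F (rotatedOrbit T Q θ i n)) K :=
  hB.conj (T (θ i)) fun n => fderiv_map_of_commute hF (T (θ i)) (hT (θ i)) (Q n)

theorem isPulseTrain_rotatedOrbit (T : G →* (EuclideanSpace ℝ (Fin k) ≃ₗᵢ[ℝ]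
    EuclideanSpace ℝ (Fin k))) (hr : 1 < r) (hQ : ∀ n, ‖Q n‖ ≤ D * r ^ (-|n|)) (m : ℕ)
    (N : ℕ → ℕ) (θ : ℕ → G) :
    IsPulseTrain (Finset.Icc 1 m) (center N) (rotatedOrbit T Q θ) r D (halfMinDist m N) where
  one_lt := hr
  separated _ hi _ hj := two_mul_halfMinDist_mul_natAbs_le m N hi hj
  norm_le i n := ((T (θ i)).norm_map (Q n)).trans_le (hQ n)

theorem norm_pulseSum_sub_le (hr : 1 < r) (hQ : ∀ n, ‖Q n‖ ≤ D * r ^ (-|n|))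
    (hL : r ^ (-halfMinDist m N) ≤ 1 / 2) {i : ℕ} (hi : i ∈ Finset.Icc 1 m) {n : ℤ}
    (hn : n ∈ leftDomain N i ∪ rightDomain m N i) :
    ‖pulseSum T Q m N θ (center N i + n) - T (θ i) (Q n)‖
      ≤ 4 * D * r * r ^ (-halfMinDist m N) := by
  have := (isPulseTrain_rotatedOrbit T hr hQ m N θ).norm_superposition_sub_le (a := 1) hL hi
    fun j hj => abs_center_sub_le_of_mem_domain hi hj hn
  rwa [add_sub_cancel_left, pow_one] at this

theorem norm_pulseSum_midpoint_le (hr : 1 < r) (hQ : ∀ n, ‖Q n‖ ≤ D * r ^ (-|n|))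
    (hL : r ^ (-halfMinDist m N) ≤ 1 / 2) {i : ℕ} (hi : 1 ≤ i) (him : i + 1 ≤ m) :
    ‖pulseSum T Q m N θ (center N i + distPlus N i) - T (θ i) (Q (distPlus N i))
        - T (θ (i + 1)) (Q (-distMinus N i))‖ ≤ 8 * D * (r ^ (-halfMinDist m N)) ^ 2 := by
  have := (isPulseTrain_rotatedOrbit T hr hQ m N θ).norm_superposition_sub_sub_le hL
    (Finset.mem_Icc.2 ⟨hi, by omega⟩) (Finset.mem_Icc.2 ⟨by omega, him⟩) i.succ_ne_self
    (n := center N i + distPlus N i) fun j _ hji _ => abs_center_sub_le_of_ne hi hji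
  have hshift : center N i + distPlus N i - center N (i + 1) = -distMinus N i := by
    rw [center_succ N hi, distMinus]
    ring
  rwa [add_sub_cancel_left, hshift] at this

theorem remaindersLE_of_norm_sub_pulseSum_le (hr : 1 < r) (hQ : ∀ n, ‖Q n‖ ≤ D * r ^ (-|n|))
    (hL : r ^ (-halfMinDist m N) ≤ 1 / 2) (hU : ∀ n, ‖U n - pulseSum T Q m N θ n‖ ≤ e) :
    RemaindersLE T Q m N θ U (e + 4 * D * r * r ^ (-halfMinDist m N)) :=
  fun _ hi him _ hn => (norm_sub_le_norm_sub_add_norm_sub _ _ _).trans <|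
    add_le_add (hU _) (norm_pulseSum_sub_le hr hQ hL (Finset.mem_Icc.2 ⟨hi, him⟩) hn)

theorem RemaindersLE.mono (hU : RemaindersLE T Q m N θ U δ) {δ' : ℝ} (hδ : δ ≤ δ') :
    RemaindersLE T Q m N θ U δ' :=
  fun i hi him n hn => (hU i hi him n hn).trans hδ

theorem RemaindersLE.norm_sub_pulseSum_le (hV : RemaindersLE T Q m N θ V δ) (hr : 1 < r)
    (hQ : ∀ n, ‖Q n‖ ≤ D * r ^ (-|n|)) (hL : r ^ (-halfMinDist m N) ≤ 1 / 2) (hm : 1 ≤ m) (n : ℤ) :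
    ‖V n - pulseSum T Q m N θ n‖ ≤ δ + 4 * D * r * r ^ (-halfMinDist m N) := by
  obtain ⟨i, hi, him, hn⟩ := exists_mem_domain hm N n
  have hVi := hV i hi him _ hn
  have hWi := norm_pulseSum_sub_le (T := T) (θ := θ) hr hQ hL (Finset.mem_Icc.2 ⟨hi, him⟩) hn
  rw [remainder, add_sub_cancel] at hVi
  rw [add_sub_cancel] at hWi
  simpa only [sub_sub_sub_cancel_right] using norm_sub_le_of_le hVi hWi

theorem norm_remainder_midpoint_le (hr : 1 < r) (hQ : ∀ n, ‖Q n‖ ≤ D * r ^ (-|n|))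
    (hL : r ^ (-halfMinDist m N) ≤ 1 / 2) (hU : ∀ n, ‖U n - pulseSum T Q m N θ n‖ ≤ e) {i : ℕ}
    (hi : 1 ≤ i) (him : i + 1 ≤ m) :
    ‖remainder T Q N θ U i (distPlus N i) - T (θ (i + 1)) (Q (-distMinus N i))‖
        ≤ e + 8 * D * (r ^ (-halfMinDist m N)) ^ 2 ∧
      ‖remainder T Q N θ U (i + 1) (-distMinus N i) - T (θ i) (Q (distPlus N i))‖
        ≤ e + 8 * D * (r ^ (-halfMinDist m N)) ^ 2 := by
  have hmidpoint : center N (i + 1) + -distMinus N i = center N i + distPlus N i := by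
    rw [center_succ N hi, distMinus]
    ring
  rw [remainder, remainder, hmidpoint, sub_right_comm _ (T (θ (i + 1)) _), and_self]
  have := norm_add_le_of_le (hU (center N i + distPlus N i))
    (norm_pulseSum_midpoint_le (T := T) (θ := θ) hr hQ hL hi him)
  rwa [← add_sub_assoc, ← add_sub_assoc, sub_add_cancel] at this

theorem remainder_estimates_of_norm_sub_pulseSum_le (hr : 1 < r) (hD : 0 ≤ D)
    (hQ : ∀ n, ‖Q n‖ ≤ D * r ^ (-|n|)) (hL : r ^ (-halfMinDist m N) ≤ 1 / 2) {C : ℝ} (hC : 0 ≤ C)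
    (hU : ∀ n, ‖U n - pulseSum T Q m N θ n‖ ≤ C * (r ^ (-halfMinDist m N)) ^ 2) :
    RemaindersLE T Q m N θ U ((C + 4 * D * r + 8 * D) * r ^ (-halfMinDist m N)) ∧
      ∀ i : ℕ, 1 ≤ i → i ≤ m - 1 →
        ‖remainder T Q N θ U i (distPlus N i) - T (θ (i + 1)) (Q (-distMinus N i))‖
          ≤ (C + 4 * D * r + 8 * D) * r ^ (-2 * halfMinDist m N) ∧
        ‖remainder T Q N θ U (i + 1) (-distMinus N i) - T (θ i) (Q (distPlus N i))‖
          ≤ (C + 4 * D * r + 8 * D) * r ^ (-2 * halfMinDist m N) := by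
  have hr₀ : 0 < r := one_pos.trans hr
  have hsq : r ^ (-2 * halfMinDist m N) = (r ^ (-halfMinDist m N)) ^ 2 := by
    rw [neg_mul, two_mul, neg_add, Real.rpow_add hr₀, ← sq]
  rw [hsq]
  have hLsq : (r ^ (-halfMinDist m N)) ^ 2 ≤ r ^ (-halfMinDist m N) :=
    pow_le_of_le_one (by positivity) (hL.trans one_half_lt_one.le) two_ne_zero
  refine ⟨(remaindersLE_of_norm_sub_pulseSum_le hr hQ hL hU).mono ?_, fun i hi him =>
    (norm_remainder_midpoint_le hr hQ hL hU hi (by omega)).imp (·.trans ?_) (·.trans ?_)⟩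
  · rw [add_mul, add_mul]
    exact le_add_of_le_of_nonneg (by gcongr) (by positivity)
  all_goals
    rw [← add_mul]
    gcongr
    exact le_add_of_nonneg_right (by positivity)

theorem eventually_rpow_neg_le (hr : 1 < r) (a : ℝ) {ε : ℝ} (hε : 0 < ε) :
    ∀ᶠ L : ℝ in atTop, r ^ (-L) ≤ 1 / 2 ∧ a * r ^ (-L) ≤ ε := by
  have htend := tendsto_rpow_neg_atTop_of_one_lt hr
  exact (htend.eventually_le_const one_half_pos).and
    ((htend.const_mul a).eventually_le_const (by rwa [mul_zero]))

theorem exists_pulseSum_shadowing (hF : ContDiff ℝ 2 F) (hT : ∀ (g : G) U, F (T g U) = T g (F U))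
    (hF0 : F 0 = 0) (hr : IsHyperbolic (fderiv ℝ F 0) r) (hQ : IsHomoclinicOrbit F Q)
    (htrans : IntersectTransverselyAlong F Q) :
    ∃ D > 0, (∀ n, ‖Q n‖ ≤ D * r ^ (-|n|)) ∧ ∃ ρ > 0, ∃ C ≥ 0, ∀ᶠ L : ℝ in atTop,
      ∀ (m : ℕ) (N : ℕ → ℕ) (θ : ℕ → G), 1 ≤ m → halfMinDist m N = L →
        (∀ U V, IsOrbit F U → IsOrbit F V → (∀ n, ‖U n - pulseSum T Q m N θ n‖ ≤ ρ) →
          (∀ n, ‖V n - pulseSum T Q m N θ n‖ ≤ ρ) → V = U) ∧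
        ∃ U, IsHomoclinicOrbit F U ∧ ∀ n, ‖U n - pulseSum T Q m N θ n‖ ≤ C * (r ^ (-L)) ^ 2 := by
  have hF₁ : ContDiff ℝ 1 F := hF.of_le one_le_two
  obtain ⟨K₀, g, hg⟩ := hr.exists_isGreenFunction
  obtain ⟨K, hK, hB⟩ := exists_hasAPrioriBound_of_transverse hF₁
    (hg.bijective_differenceOp (variationalCoeff_apply hF₁ 0)) hQ htrans
  obtain ⟨D, hD, hQD⟩ := hQ.exists_exponential_decay hF hF0 hg
  obtain ⟨ρ, hρ, C, hC, hshadow⟩ := exists_superposition_shadowing hF hF0 hg hK D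
  refine ⟨D, hD, hQD, ρ, hρ, C, hC, hshadow.mono ?_⟩
  rintro _ hL m N θ hm rfl
  exact hL _ _ _ (Finset.nonempty_Icc.2 hm) (isPulseTrain_rotatedOrbit T hr.one_lt hQD m N θ)
    (isOrbit_rotatedOrbit hT hQ.1 θ)
    (hasAPrioriBound_rotatedOrbit (hF₁.differentiable one_ne_zero) hT hB θ)

end Pulses

end MultiPulse

open MultiPulse in
theorem mainTheorem3_general {k : ℕ}
    (F : EuclideanSpace ℝ (Fin k) → EuclideanSpace ℝ (Fin k))
    (hF : ContDiff ℝ 2 F)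
    {G : Type*} [Group G]
    (T : G →* (EuclideanSpace ℝ (Fin k) ≃ₗᵢ[ℝ] EuclideanSpace ℝ (Fin k)))
    (hT : ∀ (g : G) (U : EuclideanSpace ℝ (Fin k)), F (T g U) = T g (F U))
    (hF0 : F 0 = 0)
    (r : ℝ) (hr : IsHyperbolic (fderiv ℝ F 0) r)
    (Q : ℤ → EuclideanSpace ℝ (Fin k)) (hQ : IsHomoclinicOrbit F Q)
    (htrans : IntersectTransverselyAlong F Q) :
    ∃ N₀ : ℕ, 0 < N₀ ∧ ∃ δ : ℝ, 0 < δ ∧ ∃ C : ℝ, 0 < C ∧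
      ∀ (m : ℕ) (N : ℕ → ℕ) (θ : ℕ → G), 1 < m →
        (∀ i : ℕ, 1 ≤ i → i ≤ m - 1 → N₀ ≤ N i) →
        ∃ U : ℤ → EuclideanSpace ℝ (Fin k),
          (IsHomoclinicOrbit F U ∧ RemaindersLE T Q m N θ U δ) ∧
          (∀ V : ℤ → EuclideanSpace ℝ (Fin k), IsOrbit F V →
            RemaindersLE T Q m N θ V δ → V = U) ∧
          RemaindersLE T Q m N θ U (C * r ^ (-halfMinDist m N)) ∧
          ∀ i : ℕ, 1 ≤ i → i ≤ m - 1 →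
            ‖remainder T Q N θ U i (distPlus N i) - T (θ (i + 1)) (Q (-distMinus N i))‖
              ≤ C * r ^ (-2 * halfMinDist m N) ∧
            ‖remainder T Q N θ U (i + 1) (-distMinus N i) - T (θ i) (Q (distPlus N i))‖
              ≤ C * r ^ (-2 * halfMinDist m N) := by
  have hr₁ := hr.one_lt
  have : 0 < r := one_pos.trans hr₁
  obtain ⟨D, hD, hQD, ρ, hρ, C, hC, hshadow⟩ := exists_pulseSum_shadowing hF hT hF0 hr hQ htrans
  obtain ⟨N₀, hN₀, hlarge⟩ := exists_forall_halfMinDist_of_eventually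
    (hshadow.and (eventually_rpow_neg_le hr₁ (C + 4 * D * r + 8 * D) (half_pos hρ)))
  refine ⟨N₀, hN₀, ρ / 2, half_pos hρ, C + 4 * D * r + 8 * D, by positivity,
    fun m N θ hm hN => ?_⟩
  obtain ⟨hexists, hL, hLρ⟩ := hlarge m N hm hN
  obtain ⟨hunique, U, hU, hUW⟩ := hexists m N θ hm.le rfl
  obtain ⟨hrem, hmid⟩ := remainder_estimates_of_norm_sub_pulseSum_le hr₁ hD.le hQD hL hC hUW
  have hnear (V) (hV : RemaindersLE T Q m N θ V (ρ / 2)) (n) :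
      ‖V n - pulseSum T Q m N θ n‖ ≤ ρ := by
    have : 4 * D * r * r ^ (-halfMinDist m N) ≤ ρ / 2 := le_trans (by gcongr; linarith) hLρ
    linarith [hV.norm_sub_pulseSum_le hr₁ hQD hL hm.le n]
  have hremρ := hrem.mono hLρ
  exact ⟨U, ⟨hU, hremρ⟩, fun V hV hVρ => hunique U V hU.1 hV (hnear U hremρ) (hnear V hVρ),
    hrem, hmid⟩

theorem mainTheorem3 {k : ℕ}
    (F : EuclideanSpace ℝ (Fin k) → EuclideanSpace ℝ (Fin k))
    (hF : ContDiff ℝ (⊤ : ℕ∞) F)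
    {G : Type*} [Group G] [Finite G]
    (T : G →* (EuclideanSpace ℝ (Fin k) ≃ₗᵢ[ℝ] EuclideanSpace ℝ (Fin k)))
    (hT : ∀ (g : G) (U : EuclideanSpace ℝ (Fin k)), F (T g U) = T g (F U))
    (hF0 : F 0 = 0)
    (r : ℝ) (hr : MultiPulse.IsHyperbolic (fderiv ℝ F 0) r)
    (Q : ℤ → EuclideanSpace ℝ (Fin k)) (hQ : MultiPulse.IsHomoclinicOrbit F Q)
    (htrans : MultiPulse.IntersectTransverselyAlong F Q) :
    ∃ N₀ : ℕ, 0 < N₀ ∧ ∃ δ : ℝ, 0 < δ ∧ ∃ C : ℝ, 0 < C ∧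
      ∀ (m : ℕ) (N : ℕ → ℕ) (θ : ℕ → G), 1 < m →
        (∀ i : ℕ, 1 ≤ i → i ≤ m - 1 → N₀ ≤ N i) →
        ∃ U : ℤ → EuclideanSpace ℝ (Fin k),
          -- `U` is an `m`-pulse solution, and the only one
          (MultiPulse.IsHomoclinicOrbit F U ∧ MultiPulse.RemaindersLE T Q m N θ U δ) ∧
          (∀ V : ℤ → EuclideanSpace ℝ (Fin k), MultiPulse.IsOrbit F V →
            MultiPulse.RemaindersLE T Q m N θ V δ → V = U) ∧
          -- the estimates of its remainder terms
          MultiPulse.RemaindersLE T Q m N θ U (C * r ^ (-MultiPulse.halfMinDist m N)) ∧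
          ∀ i : ℕ, 1 ≤ i → i ≤ m - 1 →
            ‖MultiPulse.remainder T Q N θ U i (MultiPulse.distPlus N i)
                - T (θ (i + 1)) (Q (-MultiPulse.distMinus N i))‖
              ≤ C * r ^ (-2 * MultiPulse.halfMinDist m N) ∧
            ‖MultiPulse.remainder T Q N θ U (i + 1) (-MultiPulse.distMinus N i)
                - T (θ i) (Q (MultiPulse.distPlus N i))‖
              ≤ C * r ^ (-2 * MultiPulse.halfMinDist m N) :=
  mainTheorem3_general F (hF.of_le (WithTop.coe_le_coe.2 (le_top : (2 : ℕ∞) ≤ ⊤))) T hT hF0 r hr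
    Q hQ htrans
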